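/- Let $p,u,v,w\in\mathbb R^3$, $\pi=\{(x_1,x_2):0<x_1<1,\ 0<x_2<x_1\}$, $\chi_\tau(y)=p+y_1v+y_2u$, $\chi_\sigma(x)=p+x_1v+x_2w$, $\tau=\chi_\tau(\pi)$, $\sigma=\chi_\sigma(\pi)$, with Gram determinants $g_\tau=\sqrt{|v|^2|u|^2-(v\cdot u)^2}\neq0$ and $g_\sigma=\sqrt{|v|^2|w|^2-(v\cdot w)^2}\ne0$. Assume that the closed triangles intersect exactly in their common edge, $\bar\sigma\cap\bar\tau=[p,p+v]$. Let $n$ be a unit normal of $\tau$, let $\varphi(\chi_\tau(y))=a_0+a_1y_1+a_2y_2$ for $y\in\pi$, and put $c_0=a_0/2+a_1/3$, $c_1=-a_1/6$, $c_2=a_2/6$. Let $$J=\int_\sigma\int_\tau\frac{(x-y)\cdot n}{4\pi|x-y|^3}\,\varphi(y)\,dS(y)\,dS(x).$$ **(1)** The integrand of $J$ is absolutely integrable over $\sigma\times\tau$, the integrands of the $J_i$ below are absolutely integrable over $(0,1)^2$, and $$J=\frac{g_\sigma g_\tau}{4\pi}\,(w\cdot n)\sum_{i=1}^5J_i,$$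 where, all integrals being over $(\eta_3,\eta_4)\in(0,1)^2$, $$J_1=\int\frac{\eta_4\,(c_0+c_1\eta_3+c_2(1-\eta_3))}{|\eta_3(u+v)+\eta_4w-u|^3},\qquad J_2=\int\frac{\eta_3\,(c_0+c_1\eta_3\eta_4+c_2\eta_3(1-\eta_4))}{|\eta_3\eta_4(u+v)-\eta_3u+w|^3},$$ $$J_3=\int\frac{\eta_3^2(1-\eta_4)(c_0+c_2)}{|\eta_3\eta_4(w+v)-\eta_3w+u|^3},\qquad J_4=\int\frac{\eta_3(1-\eta_3)(c_0+c_2\eta_3\eta_4)}{|\eta_3\eta_4u+\eta_3(w+v)-w|^3},$$ $$J_5=\int\frac{\eta_3(1-\eta_3\eta_4)(c_0+c_2\eta_3)}{|\eta_3\eta_4(w+v)+\eta_3u-w|^3}.$$ If the triangles lie in one plane ($w\cdot n=0$), then $J=0$. **(2)** Suppose $w\cdot n\neq0$. For $i=1,\dots,5$ and $j=0,1$ let $$h^{(i)}_j=\frac{4P}{D\sqrt Q},\quad P=p_0+p_1\eta+p_2\eta^2+p_3\eta^3,\quad Q=q(q_0+q_1\eta+\eta^2),\quad D=4d(d_0+d_1\eta+\eta^2),$$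 with the following parameters ($d,d_0,d_1$ depend only on $i$), where $s=u+v$, $r=v+w$, $a=u+v+w$, $C=c_0+c_2$, $e=c_2-c_1$, and $\Delta(x,y)=|x|^2|y|^2-(x\cdot y)^2$. $$\begin{array}{c|ccc} (i,j)&q&q\,q_0&\tfrac12q\,q_1\\\hline (1,0)&|s|^2&|u|^2&-s\cdot u\\ (1,1)&|s|^2&|u-w|^2&-s\cdot(u-w)\\ (2,0)&|u|^2&|w|^2&-u\cdot w\\ (2,1)&|v|^2&|w|^2&v\cdot w\\ (3,0)&|w|^2&|u|^2&-u\cdot w\\ (3,1)&|v|^2&|u|^2&u\cdot v\\ (4,0)&|r|^2&|w|^2&-r\cdot w\\ (4,1)&|a|^2&|w|^2&-a\cdot w\\ (5,0)&|u|^2&|w|^2&-u\cdot w\\ (5,1)&|a|^2&|w|^2&-a\cdot w \end{array} \qquad \begin{array}{c|ccc} i&d&d\,d_0&\tfrac12d\,d_1\\\hline 1&\Delta(s,w)&\Delta(u,w)&(u\cdot w)(s\cdot w)-|w|^2\,s\cdot u\\ 2&\Delta(u,v)&\Delta(s,w)&(v\cdot w)(s\cdot u)-(u\cdot w)(s\cdot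 v)\\ 3&\Delta(v,w)&\Delta(r,u)&(u\cdot v)(r\cdot w)-(u\cdot w)(r\cdot v)\\ 4&\Delta(u,r)&\Delta(u,w)&(u\cdot w)(r\cdot u)-|u|^2\,r\cdot w\\ 5&\Delta(u,r)&\Delta(v,w)&(u\cdot v)(r\cdot w)-(u\cdot w)(r\cdot v) \end{array}$$ The coefficients $(p_0;\,p_1;\,p_2;\,p_3)$ are - $(1,0)$: $-C|u|^2$; $(2c_0-c_1+3c_2)|u|^2+2C\,u\cdot v$; $(2c_1-c_0-3c_2)|u|^2-C|v|^2+2(c_1-c_0-2c_2)\,u\cdot v$; $e|s|^2$. - $(1,1)$: $C(w-u)\cdot u$; $2C\,u\cdot v-C\,v\cdot w+(2c_0-c_1+3c_2)|u|^2+(c_1-c_0-2c_2)\,u\cdot w$; $(2c_1-c_0-3c_2)|u|^2-C|v|^2+2(c_1-c_0-2c_2)\,u\cdot v+e\,s\cdot w$; $e|s|^2$. - $(2,0)$: $c_0\,s\cdot w+e|w|^2$; $(2c_1-c_2)\,u\cdot w+c_2\,v\cdot w-c_0\,s\cdot u$; $-(c_1|u|^2+c_2\,u\cdot v)$; $0$.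 - $(2,1)$: $c_0\,s\cdot w+e|w|^2$; $(2c_2-c_1)\,v\cdot w+c_1\,u\cdot w+c_0\,s\cdot v$; $c_2|v|^2+c_1\,u\cdot v$; $0$. - $(3,0)$: $C|u|^2$; $C(v-w)\cdot u$; $-C\,v\cdot w$; $0$. - $(3,1)$: $C|u|^2$; $2C\,u\cdot v$; $C|v|^2$; $0$. - $(4,0)$: $-c_0\,u\cdot w-c_2|w|^2$; $c_0(v+2w)\cdot u+c_2(2v+3w)\cdot w$; $-c_0\,r\cdot u-c_2(|r|^2+2r\cdot w)$; $c_2|r|^2$. - $(4,1)$: $-c_0\,u\cdot w-c_2|w|^2$; $c_0\,s\cdot u+(2c_0+c_2)\,u\cdot w+c_2(2v+3w)\cdot w$; $-c_0\,a\cdot u-c_2\,u\cdot v-c_2|r|^2-2c_2\,a\cdot w$; $c_2\,r\cdot u+c_2|r|^2$. - $(5,0)$: $-c_0\,v\cdot w$; $c_0(v-w)\cdot u-c_2\,v\cdot w$; $c_0|u|^2+c_2(v-w)\cdot u$; $c_2|u|^2$. - $(5,1)$: $-c_0\,v\cdot w$; $c_0\,s\cdot v-c_2\,v\cdot w+c_0(v-u)\cdot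 w$; $c_0\,a\cdot u+c_2(s\cdot v+(v-u)\cdot w)$; $c_2\,a\cdot u$. For every $i$, integrating the integrand of $J_i$ over $\eta_4\in(0,1)$ gives $h^{(i)}_1(\eta_3)-h^{(i)}_0(\eta_3)$ for every $\eta_3\in[0,1]$, and $$J_i=\int_0^1h^{(i)}_1(\eta)\,d\eta-\int_0^1h^{(i)}_0(\eta)\,d\eta .$$ **(3)** Suppose $w\cdot n\ne0$ and let $h=h^{(i)}_j$ be any of these ten functions. Then $q>0$, $d>0$, $Q>0$ and $D>0$ on $\mathbb R$, $h$ is integrable on $(0,1)$, and with $N=p_0-d_0p_2+d_0d_1p_3$, $M=p_1-d_1p_2-d_0p_3+d_1^2p_3$, $$h(\eta)=\frac1{d\sqrt{Q(\eta)}}\Bigl(p_2-d_1p_3+p_3\eta+\frac{N+M\eta}{d_0+d_1\eta+\eta^2}\Bigr).$$ Moreover $$\int_0^1h\,d\eta=\frac1{d\sqrt q}\Bigl(\Bigl[p_3\sqrt{q_0+q_1\eta+\eta^2}+\bigl(p_2-d_1p_3-\tfrac{p_3q_1}2\bigr)F(\eta)\Bigr]_0^1+T\Bigr),$$ with $F(\eta)=\ln\bigl(2\sqrt{q_0+q_1\eta+\eta^2}+2\eta+q_1\bigr)$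 and $T$ given as follows. Put $$G(\rho,s)=\begin{cases}\arctan(s/\sqrt\rho)/\sqrt\rho,&\rho>0,\\-1/s,&\rho=0,\\\frac1{2\sqrt{-\rho}}\ln\Bigl|\frac{s-\sqrt{-\rho}}{s+\sqrt{-\rho}}\Bigr|,&\rho<0,\end{cases}\qquad G(\rho,\infty)=\begin{cases}\frac{\pi}{2\sqrt\rho},&\rho>0,\\0,&\rho\le0.\end{cases}$$ *Case $d_1\neq q_1$.* The equation $(d_1-q_1)z^2+2(d_0-q_0)z+(q_1d_0-d_1q_0)=0$ has exactly two real solutions $\nu<\mu$. Put $$\omega=\frac{\mu-\nu}{(\mu^2+d_1\mu+d_0)\sqrt{\mu^2+q_1\mu+q_0}},\quad\lambda=\frac{\nu^2+d_1\nu+d_0}{\mu^2+d_1\mu+d_0},\quad\varkappa=\frac{\nu^2+q_1\nu+q_0}{\mu^2+q_1\mu+q_0},$$ $$s_0(t)=\frac t{\sqrt{\varkappa+t^2}},\qquad s_1(t)=\sqrt{\varkappa+t^2},$$ $$H(t)=\omega\,\mathrm{sgn}(1+t)\Bigl[\tfrac{N+M\nu}{\varkappa-\lambda}G\bigl(\tfrac{\lambda}{\varkappa-\lambda},s_0(t)\bigr)+(N+M\mu)\,G(\lambda-\varkappa,s_1(t))\Bigr].$$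 For every real $\eta\neq\mu$ the function $\eta\mapsto H\bigl(\frac{\nu-\eta}{\eta-\mu}\bigr)$ has derivative $\dfrac{N+M\eta}{(d_0+d_1\eta+\eta^2)\sqrt{q_0+q_1\eta+\eta^2}}$, and $$\lim_{t\to\pm\infty}H(t)=H(\pm\infty):=\pm\omega\Bigl[\tfrac{N+M\nu}{\varkappa-\lambda}G\bigl(\tfrac\lambda{\varkappa-\lambda},\pm1\bigr)+(N+M\mu)\,G(\lambda-\varkappa,\infty)\Bigr].$$ If $\mu\notin\{0,1\}$, let $t_0$ and $t_1$ be the minimum and the maximum of $-\frac\nu\mu$ and $-\frac{\nu-1}{\mu-1}$. Then exactly one of the following two alternatives holds, and $$T=\begin{cases}H(t_1)-H(t_0),&t_0>-1\text{ or }t_1<-1,\\H(t_0)-H(-\infty)+H(\infty)-H(t_1),&t_0<-1<t_1.\end{cases}$$ If $\mu=0$, then $T=H(\nu-1)-H(-\infty)$. If $\mu=1$, then $T=H(\infty)-H(-\nu)$. *Case $d_1=q_1$.* With $\lambda=d_0-d_1^2/4$, $\varkappa=q_0-q_1^2/4$, and $s_0,s_1$ formed with this $\varkappa$, one has $T=H(1+\tfrac{q_1}2)-H(\tfrac{q_1}2)$,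 where $$H(t)=\begin{cases}\dfrac{N-Mq_1/2}{\varkappa-\lambda}\,G\bigl(\tfrac\lambda{\varkappa-\lambda},s_0(t)\bigr)+M\,G(\lambda-\varkappa,s_1(t)),&d_0\neq q_0,\\[2ex]\dfrac{N-Mq_1/2}{\varkappa}\,s_0(t)+M\,G(0,s_1(t)),&d_0=q_0.\end{cases}$$ -/

import Mathlib

open MeasureTheory Set Filter Topology
open scoped RealInnerProductSpace

noncomputable section

namespace DoubleLayer

/-- Euclidean three-space. -/
abbrev E3 : Type := EuclideanSpace ℝ (Fin 3)

/-- The reference triangle `{(x₁, x₂) | 0 < x₁ < 1, 0 < x₂ < x₁}`. -/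
def refTriangle : Set (ℝ × ℝ) := {x | 0 < x.1 ∧ x.1 < 1 ∧ 0 < x.2 ∧ x.2 < x.1}

/-- The affine reference mapping `(x₁, x₂) ↦ p + x₁ a + x₂ b`. -/
def chart (p a b : E3) (x : ℝ × ℝ) : E3 := p + x.1 • a + x.2 • b

/-- The open flat triangle parametrised by `chart p a b`; its vertices are `p`, `p + a` and
`p + a + b`. -/
def triangle (p a b : E3) : Set E3 := chart p a b '' refTriangle

/-- The Gram determinant `√(det (Jᵀ J))` of `chart p a b`, where `J = (a | b)`. -/
def gramDet (a b : E3) : ℝ := √(Matrix.gram ℝ ![a, b]).det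

/-- The double layer kernel `(x - y) · n / (4π |x - y|³)`. -/
def kernel (n x y : E3) : ℝ := ⟪x - y, n⟫ / (4 * Real.pi * ‖x - y‖ ^ 3)

/-- The double layer integral over `x ∈ σ`, `y ∈ τ` with respect to surface measure. -/
def doubleLayerIntegral (σ τ : Set E3) (n : E3) (φ : E3 → ℝ) : ℝ :=
  ∫ x in σ, ∫ y in τ, kernel n x y * φ y ∂(μHE[2]) ∂(μHE[2])

/-- The five regularised integrands, as functions of `η = (η₃, η₄)`; the index `i : Fin 5`
stands for the integral number `i + 1`. -/
def edgeIntegrand (u v w : E3) (c₀ c₁ c₂ : ℝ) (i : Fin 5) (η : ℝ × ℝ) : ℝ :=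
  ![η.2 / ‖η.1 • (u + v) + η.2 • w - u‖ ^ 3 * (c₀ + c₁ * η.1 + c₂ * (1 - η.1)),
    η.1 / ‖(η.1 * η.2) • (u + v) - η.1 • u + w‖ ^ 3
      * (c₀ + c₁ * (η.1 * η.2) + c₂ * (η.1 * (1 - η.2))),
    η.1 ^ 2 * (1 - η.2) / ‖(η.1 * η.2) • (w + v) - η.1 • w + u‖ ^ 3 * (c₀ + c₂),
    η.1 * (1 - η.1) / ‖(η.1 * η.2) • u + η.1 • (w + v) - w‖ ^ 3 * (c₀ + c₂ * (η.1 * η.2)),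
    η.1 * (1 - η.1 * η.2) / ‖(η.1 * η.2) • (w + v) + η.1 • u - w‖ ^ 3 * (c₀ + c₂ * η.1)] i

/-- The integrals `J₁, …, J₅` over the open unit square. -/
def edgeIntegral (u v w : E3) (c₀ c₁ c₂ : ℝ) (i : Fin 5) : ℝ :=
  ∫ η in Ioo (0 : ℝ) 1 ×ˢ Ioo (0 : ℝ) 1, edgeIntegrand u v w c₀ c₁ c₂ i η

/-- The parameters of an integrand `4 P / (D √Q)`. -/
structure Params where
  (q q₀ q₁ d d₀ d₁ p₀ p₁ p₂ p₃ : ℝ)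

namespace Params

variable (S : Params)

/-- `P(η) = p₀ + p₁ η + p₂ η² + p₃ η³`. -/
def P (η : ℝ) : ℝ := S.p₀ + S.p₁ * η + S.p₂ * η ^ 2 + S.p₃ * η ^ 3

/-- The monic quadratic `q₀ + q₁ η + η²`. -/
def Qm (η : ℝ) : ℝ := S.q₀ + S.q₁ * η + η ^ 2

/-- `Q(η) = q (q₀ + q₁ η + η²)`. -/
def Q (η : ℝ) : ℝ := S.q * S.Qm η

/-- The monic quadratic `d₀ + d₁ η + η²`. -/
def Dm (η : ℝ) : ℝ := S.d₀ + S.d₁ * η + η ^ 2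

/-- `D(η) = 4 d (d₀ + d₁ η + η²)`. -/
def D (η : ℝ) : ℝ := 4 * S.d * S.Dm η

/-- `h = 4 P / (D √Q)`. -/
def h (η : ℝ) : ℝ := 4 * S.P η / (S.D η * √(S.Q η))

/-- `F(η) = ln (2 √(q₀ + q₁ η + η²) + 2 η + q₁)`. -/
def F (η : ℝ) : ℝ := Real.log (2 * √(S.Qm η) + 2 * η + S.q₁)

/-- The elementary part of the antiderivative. -/
def E (η : ℝ) : ℝ :=
  S.p₃ * √(S.Qm η) + (S.p₂ - S.d₁ * S.p₃ - S.p₃ * S.q₁ / 2) * S.F η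

/-- Constant coefficient of the remainder in the partial fraction decomposition. -/
def n : ℝ := S.p₀ - S.d₀ * S.p₂ + S.d₀ * S.d₁ * S.p₃

/-- Linear coefficient of the remainder in the partial fraction decomposition. -/
def m : ℝ := S.p₁ - S.d₁ * S.p₂ - S.d₀ * S.p₃ + S.d₁ ^ 2 * S.p₃

end Params

/-- The antiderivative `G(ρ, s)` of `1 / (ρ + s²)`. -/
def G (ρ s : ℝ) : ℝ :=
  if 0 < ρ then Real.arctan (s / √ρ) / √ρ
  else if ρ = 0 then -1 / s
  else 1 / (2 * √(-ρ)) * Real.log |(s - √(-ρ)) / (s + √(-ρ))|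

/-- The limit of `G(ρ, s)` as `s → ∞`. -/
def GInfty (ρ : ℝ) : ℝ := if 0 < ρ then Real.pi / (2 * √ρ) else 0

/-- `s₀(t) = t / √(ϰ + t²)`. -/
def s₀ (ϰ t : ℝ) : ℝ := t / √(ϰ + t ^ 2)

/-- `s₁(t) = √(ϰ + t²)`. -/
def s₁ (ϰ t : ℝ) : ℝ := √(ϰ + t ^ 2)

/-- The inverse `t = (ν - η) / (η - μ)` of the substitution `η = (ν + μ t) / (1 + t)`. -/
def subst (ν μ η : ℝ) : ℝ := (ν - η) / (η - μ)

namespace Params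

variable (S : Params)

/-- `ω = (μ - ν) / ((μ² + d₁ μ + d₀) √(μ² + q₁ μ + q₀))`. -/
def omega (ν μ : ℝ) : ℝ := (μ - ν) / (S.Dm μ * √(S.Qm μ))

/-- `λ = (ν² + d₁ ν + d₀) / (μ² + d₁ μ + d₀)`. -/
def lam (ν μ : ℝ) : ℝ := S.Dm ν / S.Dm μ

/-- `ϰ = (ν² + q₁ ν + q₀) / (μ² + q₁ μ + q₀)`. -/
def kap (ν μ : ℝ) : ℝ := S.Qm ν / S.Qm μ

/-- The antiderivative `H(t)` produced by the fractional linear substitution. -/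
def H (ν μ t : ℝ) : ℝ :=
  S.omega ν μ * SignType.sign (1 + t) *
    ((S.n + S.m * ν) / (S.kap ν μ - S.lam ν μ) *
        G (S.lam ν μ / (S.kap ν μ - S.lam ν μ)) (s₀ (S.kap ν μ) t)
      + (S.n + S.m * μ) * G (S.lam ν μ - S.kap ν μ) (s₁ (S.kap ν μ) t))

/-- The closed form of the limit of `H(t)` as `t → ∞`. -/
def HTop (ν μ : ℝ) : ℝ :=
  S.omega ν μ *
    ((S.n + S.m * ν) / (S.kap ν μ - S.lam ν μ) * G (S.lam ν μ / (S.kap ν μ - S.lam ν μ)) 1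
      + (S.n + S.m * μ) * GInfty (S.lam ν μ - S.kap ν μ))

/-- The closed form of the limit of `H(t)` as `t → -∞`. -/
def HBot (ν μ : ℝ) : ℝ :=
  -S.omega ν μ *
    ((S.n + S.m * ν) / (S.kap ν μ - S.lam ν μ) * G (S.lam ν μ / (S.kap ν μ - S.lam ν μ)) (-1)
      + (S.n + S.m * μ) * GInfty (S.lam ν μ - S.kap ν μ))

/-- `d₀ - d₁² / 4`, the role of `λ` after the shift `η = t - q₁ / 2` when `d₁ = q₁`. -/
def lamShift : ℝ := S.d₀ - S.d₁ ^ 2 / 4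

/-- `q₀ - q₁² / 4`, the role of `ϰ` after the shift `η = t - q₁ / 2` when `d₁ = q₁`. -/
def kapShift : ℝ := S.q₀ - S.q₁ ^ 2 / 4

/-- The antiderivative in the shifted variable when `d₁ = q₁` and `d₀ ≠ q₀`. -/
def HShift (t : ℝ) : ℝ :=
  (S.n - S.m * S.q₁ / 2) / (S.kapShift - S.lamShift) *
      G (S.lamShift / (S.kapShift - S.lamShift)) (s₀ S.kapShift t)
    + S.m * G (S.lamShift - S.kapShift) (s₁ S.kapShift t)

/-- The antiderivative in the shifted variable when `d₁ = q₁` and `d₀ = q₀`. -/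
def HProp (t : ℝ) : ℝ :=
  (S.n - S.m * S.q₁ / 2) / S.kapShift * s₀ S.kapShift t + S.m * G 0 (s₁ S.kapShift t)

end Params

/-- Table of `q`; rows are `i = 1, …, 5`, columns are `j = 0, 1`. -/
def tabQ (u v w : E3) : Fin 5 → Fin 2 → ℝ :=
  ![![‖u + v‖ ^ 2, ‖u + v‖ ^ 2],
    ![‖u‖ ^ 2, ‖v‖ ^ 2],
    ![‖w‖ ^ 2, ‖v‖ ^ 2],
    ![‖v + w‖ ^ 2, ‖u + v + w‖ ^ 2],
    ![‖u‖ ^ 2, ‖u + v + w‖ ^ 2]]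

/-- Table of `q q₀`. -/
def tabQ₀ (u w : E3) : Fin 5 → Fin 2 → ℝ :=
  ![![‖u‖ ^ 2, ‖u - w‖ ^ 2],
    ![‖w‖ ^ 2, ‖w‖ ^ 2],
    ![‖u‖ ^ 2, ‖u‖ ^ 2],
    ![‖w‖ ^ 2, ‖w‖ ^ 2],
    ![‖w‖ ^ 2, ‖w‖ ^ 2]]

/-- Table of `q q₁ / 2`. -/
def tabQ₁ (u v w : E3) : Fin 5 → Fin 2 → ℝ :=
  ![![-⟪u + v, u⟫, -⟪u + v, u - w⟫],
    ![-⟪u, w⟫, ⟪v, w⟫],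
    ![-⟪u, w⟫, ⟪u, v⟫],
    ![-⟪v + w, w⟫, -⟪u + v + w, w⟫],
    ![-⟪u, w⟫, -⟪u + v + w, w⟫]]

/-- Table of `d`; it does not depend on `j`. -/
def tabD (u v w : E3) : Fin 5 → ℝ :=
  ![‖u + v‖ ^ 2 * ‖w‖ ^ 2 - ⟪u + v, w⟫ ^ 2,
    ‖u‖ ^ 2 * ‖v‖ ^ 2 - ⟪u, v⟫ ^ 2,
    ‖v‖ ^ 2 * ‖w‖ ^ 2 - ⟪v, w⟫ ^ 2,
    ‖u‖ ^ 2 * ‖v + w‖ ^ 2 - ⟪v + w, u⟫ ^ 2,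
    ‖u‖ ^ 2 * ‖v + w‖ ^ 2 - ⟪v + w, u⟫ ^ 2]

/-- Table of `d d₀`. -/
def tabD₀ (u v w : E3) : Fin 5 → ℝ :=
  ![‖u‖ ^ 2 * ‖w‖ ^ 2 - ⟪u, w⟫ ^ 2,
    ‖u + v‖ ^ 2 * ‖w‖ ^ 2 - ⟪u + v, w⟫ ^ 2,
    ‖v + w‖ ^ 2 * ‖u‖ ^ 2 - ⟪v + w, u⟫ ^ 2,
    ‖u‖ ^ 2 * ‖w‖ ^ 2 - ⟪u, w⟫ ^ 2,
    ‖v‖ ^ 2 * ‖w‖ ^ 2 - ⟪v, w⟫ ^ 2]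

/-- Table of `d d₁ / 2`. -/
def tabD₁ (u v w : E3) : Fin 5 → ℝ :=
  ![⟪u, w⟫ * ⟪u + v, w⟫ - ‖w‖ ^ 2 * ⟪u + v, u⟫,
    ⟪v, w⟫ * ⟪u + v, u⟫ - ⟪u, w⟫ * ⟪u + v, v⟫,
    ⟪u, v⟫ * ⟪v + w, w⟫ - ⟪u, w⟫ * ⟪v + w, v⟫,
    ⟪u, w⟫ * ⟪v + w, u⟫ - ‖u‖ ^ 2 * ⟪v + w, w⟫,
    ⟪u, v⟫ * ⟪v + w, w⟫ - ⟪u, w⟫ * ⟪v + w, v⟫]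

/-- Table of `p₀`. -/
def tabP₀ (u v w : E3) (c₀ c₁ c₂ : ℝ) : Fin 5 → Fin 2 → ℝ :=
  ![![-(c₀ + c₂) * ‖u‖ ^ 2, (c₀ + c₂) * ⟪w - u, u⟫],
    ![c₀ * ⟪u + v, w⟫ + (c₂ - c₁) * ‖w‖ ^ 2, c₀ * ⟪u + v, w⟫ + (c₂ - c₁) * ‖w‖ ^ 2],
    ![(c₀ + c₂) * ‖u‖ ^ 2, (c₀ + c₂) * ‖u‖ ^ 2],
    ![-c₀ * ⟪u, w⟫ - c₂ * ‖w‖ ^ 2, -c₀ * ⟪u, w⟫ - c₂ * ‖w‖ ^ 2],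
    ![-c₀ * ⟪v, w⟫, -c₀ * ⟪v, w⟫]]

/-- Table of `p₁`. -/
def tabP₁ (u v w : E3) (c₀ c₁ c₂ : ℝ) : Fin 5 → Fin 2 → ℝ :=
  ![![(2 * c₀ - c₁ + 3 * c₂) * ‖u‖ ^ 2 + 2 * (c₀ + c₂) * ⟪u, v⟫,
      2 * (c₀ + c₂) * ⟪u, v⟫ - (c₀ + c₂) * ⟪v, w⟫ + (2 * c₀ - c₁ + 3 * c₂) * ‖u‖ ^ 2
        + (c₁ - c₀ - 2 * c₂) * ⟪u, w⟫],
    ![(2 * c₁ - c₂) * ⟪u, w⟫ + c₂ * ⟪v, w⟫ - c₀ * ⟪u + v, u⟫,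
      (2 * c₂ - c₁) * ⟪v, w⟫ + c₁ * ⟪u, w⟫ + c₀ * ⟪u + v, v⟫],
    ![(c₀ + c₂) * ⟪v - w, u⟫, 2 * (c₀ + c₂) * ⟪u, v⟫],
    ![c₀ * ⟪v + (2 : ℝ) • w, u⟫ + c₂ * ⟪(2 : ℝ) • v + (3 : ℝ) • w, w⟫,
      c₀ * ⟪u + v, u⟫ + (2 * c₀ + c₂) * ⟪u, w⟫ + c₂ * ⟪(2 : ℝ) • v + (3 : ℝ) • w, w⟫],
    ![c₀ * ⟪v - w, u⟫ - c₂ * ⟪v, w⟫,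
      c₀ * ⟪u + v, v⟫ - c₂ * ⟪v, w⟫ + c₀ * ⟪v - u, w⟫]]

/-- Table of `p₂`. -/
def tabP₂ (u v w : E3) (c₀ c₁ c₂ : ℝ) : Fin 5 → Fin 2 → ℝ :=
  ![![(2 * c₁ - c₀ - 3 * c₂) * ‖u‖ ^ 2 - (c₀ + c₂) * ‖v‖ ^ 2
        + 2 * (c₁ - c₀ - 2 * c₂) * ⟪u, v⟫,
      (2 * c₁ - c₀ - 3 * c₂) * ‖u‖ ^ 2 - (c₀ + c₂) * ‖v‖ ^ 2
        + 2 * (c₁ - c₀ - 2 * c₂) * ⟪u, v⟫ + (c₂ - c₁) * ⟪u + v, w⟫],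
    ![-(c₁ * ‖u‖ ^ 2 + c₂ * ⟪u, v⟫), c₂ * ‖v‖ ^ 2 + c₁ * ⟪u, v⟫],
    ![-(c₀ + c₂) * ⟪v, w⟫, (c₀ + c₂) * ‖v‖ ^ 2],
    ![-c₀ * ⟪v + w, u⟫ - c₂ * (‖v + w‖ ^ 2 + 2 * ⟪v + w, w⟫),
      -c₀ * ⟪u + v + w, u⟫ - c₂ * ⟪u, v⟫ - c₂ * ‖v + w‖ ^ 2 - 2 * c₂ * ⟪u + v + w, w⟫],
    ![c₀ * ‖u‖ ^ 2 + c₂ * ⟪v - w, u⟫,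
      c₀ * ⟪u + v + w, u⟫ + c₂ * (⟪u + v, v⟫ + ⟪v - u, w⟫)]]

/-- Table of `p₃`. -/
def tabP₃ (u v w : E3) (c₁ c₂ : ℝ) : Fin 5 → Fin 2 → ℝ :=
  ![![(c₂ - c₁) * ‖u + v‖ ^ 2, (c₂ - c₁) * ‖u + v‖ ^ 2],
    ![0, 0],
    ![0, 0],
    ![c₂ * ‖v + w‖ ^ 2, c₂ * ⟪v + w, u⟫ + c₂ * ‖v + w‖ ^ 2],
    ![c₂ * ‖u‖ ^ 2, c₂ * ⟪u + v + w, u⟫]]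

/-- The parameters of the `j`-th integrand `h` belonging to the integral number `i + 1`. -/
def edgeParams (u v w : E3) (c₀ c₁ c₂ : ℝ) (i : Fin 5) (j : Fin 2) : Params where
  q := tabQ u v w i j
  q₀ := tabQ₀ u w i j / tabQ u v w i j
  q₁ := 2 * tabQ₁ u v w i j / tabQ u v w i j
  d := tabD u v w i
  d₀ := tabD₀ u v w i / tabD u v w i
  d₁ := 2 * tabD₁ u v w i / tabD u v w i
  p₀ := tabP₀ u v w c₀ c₁ c₂ i j
  p₁ := tabP₁ u v w c₀ c₁ c₂ i j
  p₂ := tabP₂ u v w c₀ c₁ c₂ i j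
  p₃ := tabP₃ u v w c₁ c₂ i j

end DoubleLayer

end

/-! In reference coordinates the normal component of `x - y` is `x₂ (w · n)`, because `v` and `u`
are orthogonal to `n`. What remains is `x₂ / |(x₁ - y₁) v + x₂ w - y₂ u|³` times an affine density.
The first factor depends only on `x₁ - y₁`, `x₂`, `y₂` and is homogeneous of degree `-2` in them.

Put `Y = max(x₁, y₁)` and `a = max(x₂ + Y - x₁, y₂ + Y - y₁)`. Then `(Y, a)` again runs through the
reference triangle, and up to null sets the product of the two triangles splits into five parts
according to which terms are largest (`iUnion_edgeRegion_ae_eq`). On each part the other two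
variables are scaled by `a`; the Jacobian contains `a²`, which cancels the homogeneity exactly
(`edgeJac_mul_refIntegrand`). The new denominators have no zero on the closed unit square: a zero
would make the triangles meet off their common edge (`eq_zero_of_triangles_meet_in_edge`). Hence
everything is integrable, and integrating out `(Y, a)` uses only the moments of the reference
triangle, which produce `c₀, c₁, c₂` (`integral_edgeJac_mul`).

If `w · n ≠ 0`, the vectors `u, v, w` are independent. As a function of `η₄` each integrand is `k (a
+ b k η₄) / |k η₄ A + B|³` with `B` affine in `η₃`, so it has an algebraic antiderivative
(`hasDerivAt_line`). Its values at the two endpoints are the functions `h`: `D` comes from the Gram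
determinant of `A, B`, and `Q` from the squared norm at the endpoint.

For the integral over `η₃`, division of `P` by the monic part of `D` leaves an elementary term and
`(N + M η) / (Dm √Qm)`. A fractional linear substitution with `ν, μ` conjugate with respect to both
quadratics removes both linear terms (`exists_roots`, `Qm_subst`, `Dm_subst`). The even and odd
parts of the result are rationalised by `s₀` and `s₁` and integrate to `G` (`hasDerivAt_bracket`).
The substitution sends `η = μ` to infinity, so when `μ` lies in `[0, 1]` the limits of `H` at `±∞`
enter. -/

noncomputable section

namespace DoubleLayer

open scoped ENNReal NNReal

/-! ### Surface measure on a parametrised triangle. -/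

/-- The linear part of `chart`, on the Euclidean plane. -/
def chartLin (a b : E3) : EuclideanSpace ℝ (Fin 2) →ₗ[ℝ] E3 where
  toFun x := x 0 • a + x 1 • b
  map_add' x y := by simp [add_smul]; abel
  map_smul' c x := by simp [mul_smul]

theorem normDet_chartLin (a b : E3) : (chartLin a b).normDet = gramDet a b := by
  have h := LinearMap.normDet_sq_eq_det_gram (chartLin a b) (EuclideanSpace.basisFun (Fin 2) ℝ)
  have h1 : (fun i => chartLin a b (EuclideanSpace.basisFun (Fin 2) ℝ i)) = ![a, b] := by
    ext i; fin_cases i <;> simp [chartLin]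
  unfold gramDet
  have h2 : (chartLin a b).normDet ^ 2 = (Matrix.gram ℝ ![a, b]).det := by
    rw [← h1]; simpa using h
  rw [← h2, Real.sqrt_sq (LinearMap.normDet_nonneg _)]

/-- The measure preserving identification of `ℝ × ℝ` with the Euclidean plane. -/
def planeEquiv : ℝ × ℝ ≃ᵐ EuclideanSpace ℝ (Fin 2) :=
  (MeasurableEquiv.finTwoArrow (α := ℝ)).symm.trans (MeasurableEquiv.toLp 2 (Fin 2 → ℝ))

theorem planeEquiv_zero (x : ℝ × ℝ) : planeEquiv x 0 = x.1 := rfl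

theorem planeEquiv_one (x : ℝ × ℝ) : planeEquiv x 1 = x.2 := rfl

theorem measurePreserving_planeEquiv : MeasurePreserving planeEquiv volume volume :=
  (volume_preserving_finTwoArrow ℝ).symm.trans (PiLp.volume_preserving_toLp (Fin 2))

theorem chart_eq (p a b : E3) (x : ℝ × ℝ) :
    chart p a b x = p + chartLin a b (planeEquiv x) := by
  simp [chart, chartLin, planeEquiv_zero, planeEquiv_one, add_assoc]

theorem continuous_chart (p a b : E3) : Continuous (chart p a b) := by
  unfold chart; fun_prop

theorem measurableSet_refTriangle : MeasurableSet refTriangle := by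
  unfold refTriangle
  measurability

theorem euclideanHausdorffMeasure_image_chart (p a b : E3) (s : Set (ℝ × ℝ)) :
    μHE[2] (chart p a b '' s) = ENNReal.ofReal (gramDet a b) * volume s := by
  have h1 : chart p a b '' s = (fun y => p + y) '' (chartLin a b '' (planeEquiv '' s)) := by
    simp only [image_image, chart_eq]
  have h2 := LinearMap.euclideanHausdorffMeasure_image_eq_normDet_mul_volume
    (chartLin a b) (planeEquiv '' s)
  rw [finrank_euclideanSpace_fin, normDet_chartLin] at h2
  have h3 := (IsometryEquiv.addLeft p).isometry.euclideanHausdorffMeasure_image (d := 2)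
    (s := chartLin a b '' (planeEquiv '' s))
  rw [h1]
  refine Eq.trans h3 ?_
  rw [h2, planeEquiv.image_eq_preimage_symm,
    measurePreserving_planeEquiv.symm.measure_preimage_equiv]

/-- The image formula holds for every subset of the parameter plane, and an image intersected with
`E` is the image of the intersection with the preimage of `E`. Therefore injectivity of the chart is
not needed here. -/
theorem restrict_triangle (p a b : E3) :
    (μHE[2] : Measure E3).restrict (triangle p a b) =
      ENNReal.ofReal (gramDet a b) • (volume.restrict refTriangle).map (chart p a b) := by
  ext E hE
  rw [Measure.restrict_apply hE, Measure.smul_apply,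
    Measure.map_apply (continuous_chart p a b).measurable hE,
    Measure.restrict_apply ((continuous_chart p a b).measurable hE), triangle,
    inter_comm, ← image_inter_preimage, euclideanHausdorffMeasure_image_chart, inter_comm]
  rfl

/-! ### The function `G`: derivative and limit at infinity. -/

/-- A single derivative formula covers all signs of `ρ`, so later arguments need no case
distinction; the only points to avoid are the zeros of `ρ + s²`. -/
theorem hasDerivAt_G {ρ s : ℝ} (h : ρ + s ^ 2 ≠ 0) : HasDerivAt (G ρ) (1 / (ρ + s ^ 2)) s := by
  rcases lt_trichotomy 0 ρ with hρ | hρ | hρ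
  · have h0 : G ρ = fun s => Real.arctan (s / √ρ) / √ρ := by
      funext s; simp [G, hρ]
    rw [h0]
    have hr : 0 < √ρ := Real.sqrt_pos.2 hρ
    refine ((((hasDerivAt_id s).div_const (√ρ)).arctan).div_const (√ρ)).congr_deriv ?_
    have h2 : ρ = √ρ ^ 2 := (Real.sq_sqrt hρ.le).symm
    have h3 : 0 < ρ + s ^ 2 := by positivity
    simp only [id]
    rw [div_pow, ← h2]
    field_simp
    rw [← h2]
  · subst hρ
    have h0 : G 0 = fun s => -1 / s := by
      funext s; simp [G]
    rw [h0]
    have hs : s ≠ 0 := by rintro rfl; simp at h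
    refine ((hasDerivAt_const s (-1 : ℝ)).div (hasDerivAt_id s) hs).congr_deriv ?_
    simp
  -- `Real.log` is even, so the absolute value can be dropped.
  · have h0 : G ρ = fun s => 1 / (2 * √(-ρ)) * Real.log ((s - √(-ρ)) / (s + √(-ρ))) := by
      funext s; simp [G, hρ.not_gt, hρ.ne, Real.log_abs]
    rw [h0]
    have hr : 0 < √(-ρ) := Real.sqrt_pos.2 (by linarith)
    have h2 : √(-ρ) ^ 2 = -ρ := Real.sq_sqrt (by linarith)
    have hfac : (s - √(-ρ)) * (s + √(-ρ)) = ρ + s ^ 2 := by linear_combination -h2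
    have hm : s - √(-ρ) ≠ 0 := by intro h'; rw [h'] at hfac; simp at hfac; exact h hfac.symm
    have hp : s + √(-ρ) ≠ 0 := by intro h'; rw [h'] at hfac; simp at hfac; exact h hfac.symm
    refine (((((hasDerivAt_id s).sub_const (√(-ρ))).div ((hasDerivAt_id s).add_const (√(-ρ)))
      hp).log (div_ne_zero hm hp)).const_mul (1 / (2 * √(-ρ)))).congr_deriv ?_
    simp only [id, Pi.div_apply]
    rw [← hfac]
    field_simp
    ring

theorem tendsto_G_atTop (ρ : ℝ) : Tendsto (G ρ) atTop (𝓝 (GInfty ρ)) := by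
  rcases lt_trichotomy 0 ρ with hρ | hρ | hρ
  · have h0 : G ρ = fun s => Real.arctan (s / √ρ) / √ρ := by
      funext s; simp [G, hρ]
    have hr : 0 < √ρ := Real.sqrt_pos.2 hρ
    have h1 : GInfty ρ = Real.pi / 2 / √ρ := by simp [GInfty, hρ, div_div]
    rw [h0, h1]
    refine Tendsto.div_const ?_ _
    exact ((Real.tendsto_arctan_atTop.mono_right nhdsWithin_le_nhds)).comp
      (tendsto_id.atTop_div_const hr)
  · subst hρ
    have h0 : G 0 = fun s => -1 / s := by
      funext s; simp [G]
    rw [h0]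
    simpa [GInfty] using (tendsto_const_nhds (x := (-1 : ℝ))).div_atTop tendsto_id
  · have h0 : G ρ = fun s => 1 / (2 * √(-ρ)) * Real.log ((s - √(-ρ)) / (s + √(-ρ))) := by
      funext s; simp [G, hρ.not_gt, hρ.ne, Real.log_abs]
    rw [h0]
    set r := √(-ρ)
    have h1 : Tendsto (fun s : ℝ => (s - r) / (s + r)) atTop (𝓝 1) := by
      have h2 : Tendsto (fun s : ℝ => 1 - 2 * r / (s + r)) atTop (𝓝 (1 - 0)) :=
        tendsto_const_nhds.sub (tendsto_const_nhds.div_atTop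
          (tendsto_atTop_add_const_right _ _ tendsto_id))
      rw [sub_zero] at h2
      refine h2.congr' ?_
      filter_upwards [eventually_gt_atTop (-r)] with s hs
      have : s + r ≠ 0 := by linarith
      field_simp
      ring
    have h3 := ((Real.continuousAt_log one_ne_zero).tendsto.comp h1).const_mul (1 / (2 * r))
    simpa [GInfty, hρ.not_gt] using h3

/-! ### Antiderivatives after the linear terms have been removed. -/

section Kernel

variable {l k : ℝ}

theorem hasDerivAt_s₀ (hk : 0 < k) (t : ℝ) :
    HasDerivAt (s₀ k) (k / ((k + t ^ 2) * √(k + t ^ 2))) t := by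
  have hp : 0 < k + t ^ 2 := by positivity
  have h1 : HasDerivAt (fun t : ℝ => k + t ^ 2) (2 * t) t := by
    simpa using ((hasDerivAt_pow 2 t).const_add k)
  have hs := Real.sqrt_pos.2 hp
  have h2 : √(k + t ^ 2) ^ 2 = k + t ^ 2 := Real.sq_sqrt hp.le
  refine ((hasDerivAt_id t).div (h1.sqrt hp.ne') hs.ne').congr_deriv ?_
  simp only [id]
  rw [h2]
  field_simp
  rw [h2]; ring

theorem hasDerivAt_s₁ (hk : 0 < k) (t : ℝ) :
    HasDerivAt (s₁ k) (t / √(k + t ^ 2)) t := by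
  have hp : 0 < k + t ^ 2 := by positivity
  have h1 : HasDerivAt (fun t : ℝ => k + t ^ 2) (2 * t) t := by
    simpa using ((hasDerivAt_pow 2 t).const_add k)
  refine (h1.sqrt hp.ne').congr_deriv ?_
  field_simp

theorem hasDerivAt_G_s₀ (hl : 0 < l) (hk : 0 < k) (hlk : l ≠ k) (t : ℝ) :
    HasDerivAt (fun t => 1 / (k - l) * G (l / (k - l)) (s₀ k t))
      (1 / ((l + t ^ 2) * √(k + t ^ 2))) t := by
  have hp : 0 < k + t ^ 2 := by positivity
  have hp' : 0 < l + t ^ 2 := by positivity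
  have hs := Real.sqrt_pos.2 hp
  have h2 : √(k + t ^ 2) ^ 2 = k + t ^ 2 := Real.sq_sqrt hp.le
  have hne : k - l ≠ 0 := sub_ne_zero.2 hlk.symm
  -- This form shows that the argument avoids the singularities of `G` whatever the sign of `k - l`.
  have key : l / (k - l) + s₀ k t ^ 2 = k * (l + t ^ 2) / ((k - l) * (k + t ^ 2)) := by
    simp only [s₀]
    rw [div_pow, h2]
    field_simp
    ring
  have hG := hasDerivAt_G (ρ := l / (k - l)) (s := s₀ k t) (by rw [key]; positivity)
  refine ((hG.comp t (hasDerivAt_s₀ hk t)).const_mul (1 / (k - l))).congr_deriv ?_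
  rw [key]
  field_simp

theorem hasDerivAt_G_s₁ (hl : 0 < l) (hk : 0 < k) (t : ℝ) :
    HasDerivAt (fun t => G (l - k) (s₁ k t)) (t / ((l + t ^ 2) * √(k + t ^ 2))) t := by
  have hp : 0 < k + t ^ 2 := by positivity
  have hp' : 0 < l + t ^ 2 := by positivity
  have key : l - k + s₁ k t ^ 2 = l + t ^ 2 := by
    simp only [s₁]; rw [Real.sq_sqrt hp.le]; ring
  have hG := hasDerivAt_G (ρ := l - k) (s := s₁ k t) (by rw [key]; positivity)
  refine (hG.comp t (hasDerivAt_s₁ hk t)).congr_deriv ?_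
  rw [key]
  field_simp

/-- The constant part of the numerator is integrated through `s₀`, and the part odd in `t` through
`s₁`; each turns its share of the integrand into `1 / (ρ + s²)` up to a constant. -/
theorem hasDerivAt_bracket (hl : 0 < l) (hk : 0 < k) (hlk : l ≠ k) (a b t : ℝ) :
    HasDerivAt (fun t => a / (k - l) * G (l / (k - l)) (s₀ k t) + b * G (l - k) (s₁ k t))
      ((a + b * t) / ((l + t ^ 2) * √(k + t ^ 2))) t := by
  have h := ((hasDerivAt_G_s₀ hl hk hlk t).const_mul a).add
    ((hasDerivAt_G_s₁ hl hk t).const_mul b)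
  refine (h.congr_deriv (by ring)).congr_of_eventuallyEq (Eventually.of_forall fun t => ?_)
  simp only [Pi.add_apply]; ring

theorem tendsto_s₁_atTop : Tendsto (s₁ k) atTop atTop :=
  Real.tendsto_sqrt_atTop.comp
    (tendsto_atTop_add_const_left _ _ (tendsto_pow_atTop two_ne_zero))

theorem tendsto_s₁_atBot : Tendsto (s₁ k) atBot atTop := by
  have h := (tendsto_s₁_atTop (k := k)).comp tendsto_neg_atBot_atTop
  refine h.congr fun t => ?_
  simp [s₁]

theorem tendsto_s₀_atTop : Tendsto (s₀ k) atTop (𝓝 1) := by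
  have h1 : Tendsto (fun t : ℝ => √(k / t ^ 2 + 1)) atTop (𝓝 (√(0 + 1))) :=
    (Real.continuous_sqrt.tendsto _).comp ((tendsto_const_nhds.div_atTop
      (tendsto_pow_atTop two_ne_zero)).add_const 1)
  have h2 := h1.inv₀ (by simp)
  simp only [zero_add, Real.sqrt_one, inv_one] at h2
  refine h2.congr' ?_
  filter_upwards [eventually_gt_atTop 0] with t ht
  have h3 : √(k + t ^ 2) = t * √(k / t ^ 2 + 1) := by
    rw [← Real.sqrt_sq ht.le, ← Real.sqrt_mul (by positivity), Real.sqrt_sq ht.le]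
    congr 1; field_simp
  rw [s₀, h3, ← div_div, div_self ht.ne', one_div]

theorem tendsto_s₀_atBot : Tendsto (s₀ k) atBot (𝓝 (-1)) := by
  have h := ((tendsto_s₀_atTop (k := k)).comp tendsto_neg_atBot_atTop).neg
  refine h.congr fun t => ?_
  simp [s₀, neg_div]

theorem continuousAt_G {ρ s : ℝ} (h : ρ + s ^ 2 ≠ 0) : ContinuousAt (G ρ) s :=
  (hasDerivAt_G h).continuousAt

theorem tendsto_bracket (hk : 0 < k) (hlk : l ≠ k) (a b : ℝ) {F : Filter ℝ} {e : ℝ}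
    (he : e ^ 2 = 1) (h₀ : Tendsto (s₀ k) F (𝓝 e)) (h₁ : Tendsto (s₁ k) F atTop) :
    Tendsto (fun t => a / (k - l) * G (l / (k - l)) (s₀ k t) + b * G (l - k) (s₁ k t)) F
      (𝓝 (a / (k - l) * G (l / (k - l)) e + b * GInfty (l - k))) := by
  have hne : k - l ≠ 0 := sub_ne_zero.2 hlk.symm
  -- Since `e² = 1`, the sum is `k / (k - l)`, so `G` is continuous at `±1` also when its parameter
  -- is negative.
  have h2 : l / (k - l) + e ^ 2 ≠ 0 := by
    rw [he]; intro h; field_simp at h; simp at h; exact hk.ne' h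
  exact (((continuousAt_G h2).tendsto.comp h₀).const_mul _).add
    (((tendsto_G_atTop _).comp h₁).const_mul _)

end Kernel

/-! ### Conjugate roots, partial fractions and the elementary part. -/

/-- A real quadratic equation with positive discriminant has exactly two roots. -/
theorem exists_two_roots {a b c : ℝ} (ha : a ≠ 0) (h : 0 < b ^ 2 - a * c) :
    ∃ ν μ : ℝ, ν < μ ∧ a * (ν + μ) = -2 * b ∧ a * (ν * μ) = c ∧
      ∀ z, a * z ^ 2 + 2 * b * z + c = 0 ↔ z = ν ∨ z = μ := by
  -- With `|a|` instead of `a`, subtracting `r` gives the smaller root for either sign of `a`.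
  have hr : 0 < √(b ^ 2 - a * c) / |a| := div_pos (Real.sqrt_pos.2 h) (abs_pos.2 ha)
  set r := √(b ^ 2 - a * c) / |a| with hrd
  have hr2 : a ^ 2 * r ^ 2 = b ^ 2 - a * c := by
    rw [hrd, div_pow, Real.sq_sqrt h.le, sq_abs]; field_simp
  have hprod : a * ((-b / a - r) * (-b / a + r)) = c := by
    have : a * (a * ((-b / a - r) * (-b / a + r))) = a * c := by
      have h1 : a * (-b / a) = -b := by field_simp
      linear_combination (a * (-b / a) - b) * h1 - hr2
    exact mul_left_cancel₀ ha this
  refine ⟨-b / a - r, -b / a + r, by linarith, by field_simp; ring, hprod, fun z => ?_⟩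
  have hfac : a * z ^ 2 + 2 * b * z + c = a * ((z - (-b / a - r)) * (z - (-b / a + r))) := by
    have h1 : a * (-b / a) = -b := by field_simp
    linear_combination 2 * z * h1 - hprod
  rw [hfac, mul_eq_zero, mul_eq_zero, sub_eq_zero, sub_eq_zero]
  simp [ha]

namespace Params

variable {S : Params}

theorem continuous_Qm : Continuous S.Qm := by unfold Qm; fun_prop

theorem continuous_Dm : Continuous S.Dm := by unfold Dm; fun_prop

theorem h_eq (hq : 0 < S.q) (hd : 0 < S.d) (hQ : ∀ η, 0 < S.Qm η) (hD : ∀ η, 0 < S.Dm η)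
    (η : ℝ) : S.h η = 1 / (S.d * √(S.Q η)) *
      (S.p₂ - S.d₁ * S.p₃ + S.p₃ * η + (S.n + S.m * η) / S.Dm η) := by
  have h1 : 0 < √(S.Q η) := Real.sqrt_pos.2 (mul_pos hq (hQ η))
  have h2 := hD η
  have h3 : S.P η = (S.p₂ - S.d₁ * S.p₃ + S.p₃ * η) * S.Dm η + (S.n + S.m * η) := by
    unfold P Dm n m; ring
  rw [h, D, h3]
  field_simp

theorem hasDerivAt_Qm (η : ℝ) : HasDerivAt S.Qm (S.q₁ + 2 * η) η := by
  have := (((hasDerivAt_id η).const_mul S.q₁).const_add S.q₀).add (hasDerivAt_pow 2 η)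
  exact this.congr_deriv (by simp)

theorem hasDerivAt_E (hQ : ∀ η, 0 < S.Qm η) (η : ℝ) :
    HasDerivAt S.E ((S.p₂ - S.d₁ * S.p₃ + S.p₃ * η) / √(S.Qm η)) η := by
  have hs : 0 < √(S.Qm η) := Real.sqrt_pos.2 (hQ η)
  have h2 : √(S.Qm η) ^ 2 = S.Qm η := Real.sq_sqrt (hQ η).le
  have hsq := (S.hasDerivAt_Qm η).sqrt (hQ η).ne'
  -- The difference `4 Qm(η) - (2η + q₁)²` is the constant `4q₀ - q₁²`, which is positive because it
  -- equals `4 Qm(-q₁/2)`.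
  have hpos : 0 < 2 * √(S.Qm η) + 2 * η + S.q₁ := by
    have h3 := hQ (-S.q₁ / 2)
    have h4 : (2 * η + S.q₁) ^ 2 < (2 * √(S.Qm η)) ^ 2 := by
      rw [mul_pow, h2]; unfold Qm at h3 ⊢; nlinarith
    have := (abs_lt_of_sq_lt_sq' h4 (by positivity)).1
    linarith
  have hF := ((hsq.const_mul 2).add ((hasDerivAt_id η).const_mul 2)).add_const S.q₁
  have hF' : HasDerivAt S.F (1 / √(S.Qm η)) η := by
    refine (hF.log hpos.ne').congr_deriv ?_
    have h5 : 2 * ((S.q₁ + 2 * η) / (2 * √(S.Qm η))) + 2 * 1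
        = (2 * √(S.Qm η) + 2 * η + S.q₁) / √(S.Qm η) := by field_simp; ring
    simp only [Pi.add_apply, id, h5]
    rw [div_div_cancel_left' hpos.ne', one_div]
  refine ((hsq.const_mul S.p₃).add
    (hF'.const_mul (S.p₂ - S.d₁ * S.p₃ - S.p₃ * S.q₁ / 2))).congr_deriv ?_
  field_simp
  ring

/-- The part of the integrand that is not elementary. -/
def rem (S : Params) (η : ℝ) : ℝ := (S.n + S.m * η) / (S.Dm η * √(S.Qm η))

theorem continuous_rem (hQ : ∀ η, 0 < S.Qm η) (hD : ∀ η, 0 < S.Dm η) : Continuous S.rem := by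
  unfold rem
  exact Continuous.div (by fun_prop) (continuous_Dm.mul continuous_Qm.sqrt)
    fun η => (mul_pos (hD η) (Real.sqrt_pos.2 (hQ η))).ne'

theorem h_eq_add (hq : 0 < S.q) (hd : 0 < S.d) (hQ : ∀ η, 0 < S.Qm η) (hD : ∀ η, 0 < S.Dm η)
    (η : ℝ) : S.h η = 1 / (S.d * √S.q) *
      ((S.p₂ - S.d₁ * S.p₃ + S.p₃ * η) / √(S.Qm η) + S.rem η) := by
  have h1 : 0 < √(S.Qm η) := Real.sqrt_pos.2 (hQ η)
  have h2 := hD η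
  have h3 := Real.sqrt_pos.2 hq
  rw [h_eq hq hd hQ hD, Q, Real.sqrt_mul hq.le, rem]
  field_simp

theorem continuous_elem (hQ : ∀ η, 0 < S.Qm η) :
    Continuous fun η => (S.p₂ - S.d₁ * S.p₃ + S.p₃ * η) / √(S.Qm η) :=
  Continuous.div (by fun_prop) continuous_Qm.sqrt fun η => (Real.sqrt_pos.2 (hQ η)).ne'

theorem continuous_h (hq : 0 < S.q) (hd : 0 < S.d) (hQ : ∀ η, 0 < S.Qm η)
    (hD : ∀ η, 0 < S.Dm η) : Continuous S.h := by
  have : S.h = _ := funext (h_eq_add hq hd hQ hD)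
  rw [this]
  exact ((continuous_elem hQ).add (continuous_rem hQ hD)).const_mul _

theorem integral_h (hq : 0 < S.q) (hd : 0 < S.d) (hQ : ∀ η, 0 < S.Qm η) (hD : ∀ η, 0 < S.Dm η) :
    ∫ η in (0 : ℝ)..1, S.h η =
      1 / (S.d * √S.q) * (S.E 1 - S.E 0 + ∫ η in (0 : ℝ)..1, S.rem η) := by
  simp_rw [h_eq_add hq hd hQ hD]
  rw [intervalIntegral.integral_const_mul, intervalIntegral.integral_add
    ((continuous_elem hQ).intervalIntegrable _ _) ((continuous_rem hQ hD).intervalIntegrable _ _),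
    intervalIntegral.integral_eq_sub_of_hasDerivAt (fun x _ => hasDerivAt_E hQ x)
      ((continuous_elem hQ).intervalIntegrable _ _)]

/-- The last two equations say that the polar forms of `Qm` and `Dm` vanish at `(ν, μ)`. They are
linear in `ν + μ` and `νμ`, and solving them gives the stated quadratic. -/
theorem exists_roots (hQ : ∀ η, 0 < S.Qm η) (h1 : S.d₁ ≠ S.q₁) :
    ∃ ν μ : ℝ, ν < μ ∧
      (∀ z : ℝ, (S.d₁ - S.q₁) * z ^ 2 + 2 * (S.d₀ - S.q₀) * z
        + (S.q₁ * S.d₀ - S.d₁ * S.q₀) = 0 ↔ z = ν ∨ z = μ) ∧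
      2 * (ν * μ) + S.q₁ * (ν + μ) + 2 * S.q₀ = 0 ∧
      2 * (ν * μ) + S.d₁ * (ν + μ) + 2 * S.d₀ = 0 := by
  have ha : S.d₁ - S.q₁ ≠ 0 := sub_ne_zero.2 h1
  have hk : 0 < S.q₀ - S.q₁ ^ 2 / 4 := by
    have := hQ (-S.q₁ / 2)
    unfold Qm at this
    linarith
  have hdisc : 0 < (S.d₀ - S.q₀) ^ 2
      - (S.d₁ - S.q₁) * (S.q₁ * S.d₀ - S.d₁ * S.q₀) := by
    have h2 : 0 < (S.d₁ - S.q₁) ^ 2 * (S.q₀ - S.q₁ ^ 2 / 4) := by positivity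
    -- The discriminant is a square plus a positive multiple of the minimum `q₀ - q₁²/4` of `Qm`, so
    -- both roots are real and distinct.
    have h3 : (S.d₀ - S.q₀) ^ 2 - (S.d₁ - S.q₁) * (S.q₁ * S.d₀ - S.d₁ * S.q₀)
        = (S.d₀ - S.d₁ * S.q₁ / 2 + S.q₁ ^ 2 / 4 - (S.q₀ - S.q₁ ^ 2 / 4)) ^ 2
          + (S.d₁ - S.q₁) ^ 2 * (S.q₀ - S.q₁ ^ 2 / 4) := by ring
    rw [h3]; positivity
  obtain ⟨ν, μ, hlt, hs, hp, hz⟩ := exists_two_roots ha hdisc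
  refine ⟨ν, μ, hlt, hz, ?_, ?_⟩
  · refine mul_left_cancel₀ ha ?_
    linear_combination 2 * hp + S.q₁ * hs
  · refine mul_left_cancel₀ ha ?_
    linear_combination 2 * hp + S.d₁ * hs

/-! ### The fractional linear substitution and the passage through its pole. -/

section Substitution

variable {ν μ : ℝ} (hνμ : ν < μ) (hQ : ∀ η, 0 < S.Qm η) (hD : ∀ η, 0 < S.Dm η)
  (hq' : 2 * (ν * μ) + S.q₁ * (ν + μ) + 2 * S.q₀ = 0)
  (hd' : 2 * (ν * μ) + S.d₁ * (ν + μ) + 2 * S.d₀ = 0)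

theorem one_add_subst {η : ℝ} (h : η ≠ μ) : 1 + subst ν μ η = (ν - μ) / (η - μ) := by
  have : η - μ ≠ 0 := sub_ne_zero.2 h
  rw [subst]; field_simp; ring

-- In the basis of squares and product of `η - μ` and `ν - η`, the coefficient of the mixed product
-- is the polar form at `(ν, μ)`, which `hq'` makes zero.
include hq' in
theorem Qm_subst {η : ℝ} (h : η ≠ μ) (hQ : ∀ η, 0 < S.Qm η) :
    S.Qm η * (1 + subst ν μ η) ^ 2 = S.Qm μ * (S.kap ν μ + subst ν μ η ^ 2) := by
  have h1 : η - μ ≠ 0 := sub_ne_zero.2 h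
  have h2 : (ν - μ) ^ 2 * S.Qm η = S.Qm ν * (η - μ) ^ 2 + S.Qm μ * (ν - η) ^ 2 := by
    unfold Qm
    linear_combination (η - μ) * (ν - η) * hq'
  rw [one_add_subst h, kap, subst, mul_add, mul_div_cancel₀ _ (hQ μ).ne', div_pow, div_pow]
  field_simp
  linear_combination h2

include hd' in
theorem Dm_subst {η : ℝ} (h : η ≠ μ) (hD : ∀ η, 0 < S.Dm η) :
    S.Dm η * (1 + subst ν μ η) ^ 2 = S.Dm μ * (S.lam ν μ + subst ν μ η ^ 2) := by
  have h1 : η - μ ≠ 0 := sub_ne_zero.2 h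
  have h2 : (ν - μ) ^ 2 * S.Dm η = S.Dm ν * (η - μ) ^ 2 + S.Dm μ * (ν - η) ^ 2 := by
    unfold Dm
    linear_combination (η - μ) * (ν - η) * hd'
  rw [one_add_subst h, lam, subst, mul_add, mul_div_cancel₀ _ (hD μ).ne', div_pow, div_pow]
  field_simp
  linear_combination h2

-- Equality would make the two quadratics proportional; both are monic, hence they would coincide,
-- against `d₁ ≠ q₁`.
include hνμ hQ hD hq' hd' in
theorem lam_ne_kap (h1 : S.d₁ ≠ S.q₁) : S.lam ν μ ≠ S.kap ν μ := by
  intro h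
  have hDμ := hD μ
  have hQμ := hQ μ
  have hne : (ν - μ) ^ 2 ≠ 0 := pow_ne_zero 2 (sub_ne_zero.2 hνμ.ne)
  rw [lam, kap, div_eq_div_iff hDμ.ne' hQμ.ne'] at h
  have hprop : ∀ η, S.Dm μ * S.Qm η = S.Qm μ * S.Dm η := by
    intro η
    have h2 : (ν - μ) ^ 2 * S.Qm η = S.Qm ν * (η - μ) ^ 2 + S.Qm μ * (ν - η) ^ 2 := by
      unfold Qm
      linear_combination (η - μ) * (ν - η) * hq'
    have h3 : (ν - μ) ^ 2 * S.Dm η = S.Dm ν * (η - μ) ^ 2 + S.Dm μ * (ν - η) ^ 2 := by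
      unfold Dm
      linear_combination (η - μ) * (ν - η) * hd'
    refine mul_left_cancel₀ hne ?_
    linear_combination S.Dm μ * h2 - S.Qm μ * h3 - (η - μ) ^ 2 * h
  generalize S.Dm μ = a at *
  generalize S.Qm μ = b at *
  -- Three values determine a quadratic: they first give equal leading factors and then equal linear
  -- coefficients.
  have e0 := hprop 0
  have e1 := hprop 1
  have e2 := hprop (-1)
  unfold Qm Dm at e0 e1 e2
  have hab : a = b := by linarith
  subst hab
  have : a * S.q₁ = a * S.d₁ := by linarith
  exact h1 (mul_left_cancel₀ hDμ.ne' this).symm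

-- In powers of `1 + t`, the numerator, `Dm` and `dη/dt` cancel except for one factor `1 + t`, while
-- `√Qm` contributes `|1 + t|`. The quotient is the sign of `1 + t`, which is why `H` carries that
-- factor.
include hνμ hQ hD hq' hd' in
theorem hasDerivAt_H_subst (h1 : S.d₁ ≠ S.q₁) {η : ℝ} (hη : η ≠ μ) :
    HasDerivAt (fun x => S.H ν μ (subst ν μ x)) (S.rem η) η := by
  have hDμ := hD μ
  have hQμ := hQ μ
  have hl : 0 < S.lam ν μ := div_pos (hD ν) hDμ
  have hk : 0 < S.kap ν μ := div_pos (hQ ν) hQμ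
  have hlk := lam_ne_kap hνμ hQ hD hq' hd' h1
  have hημ : η - μ ≠ 0 := sub_ne_zero.2 hη
  have hνμ' : ν - μ ≠ 0 := sub_ne_zero.2 hνμ.ne
  have hsub : HasDerivAt (subst ν μ) ((μ - ν) / (η - μ) ^ 2) η := by
    refine (((hasDerivAt_id η).const_sub ν).div ((hasDerivAt_id η).sub_const μ)
      hημ).congr_deriv ?_
    simp only [id]; ring
  have hB := (hasDerivAt_bracket hl hk hlk (S.n + S.m * ν) (S.n + S.m * μ)
    (subst ν μ η)).comp η hsub
  have hQs := Qm_subst hq' hη hQ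
  have hDs := Dm_subst hd' hη hD
  have hlin : (S.n + S.m * ν) + (S.n + S.m * μ) * subst ν μ η
      = (S.n + S.m * η) * (1 + subst ν μ η) := by
    rw [subst]; field_simp; ring
  have hd1 : (μ - ν) / (η - μ) ^ 2 = (1 + subst ν μ η) ^ 2 / (μ - ν) := by
    have : μ - ν ≠ 0 := sub_ne_zero.2 hνμ.ne'
    rw [one_add_subst hη]; field_simp; ring
  have hT0 : 1 + subst ν μ η ≠ 0 := by
    rw [one_add_subst hη]; exact div_ne_zero hνμ' hημ
  -- Away from the pole the sign is locally constant, so it may be differentiated as a constant.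
  have hsign : ∀ᶠ x in 𝓝 η,
      SignType.sign (1 + subst ν μ x) = SignType.sign (1 + subst ν μ η) := by
    rcases lt_or_gt_of_ne hT0 with h | h
    · filter_upwards [(hsub.continuousAt.const_add 1).eventually_lt_const h] with x hx
      rw [sign_neg h, sign_neg hx]
    · filter_upwards [(hsub.continuousAt.const_add 1).eventually_const_lt h] with x hx
      rw [sign_pos h, sign_pos hx]
  have hH := hB.const_mul (S.omega ν μ * (SignType.sign (1 + subst ν μ η) : ℝ))
  refine (hH.congr_deriv ?_).congr_of_eventuallyEq ?_
  · rw [hlin, hd1, omega, rem]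
    set t := subst ν μ η
    have hp : 0 < S.kap ν μ + t ^ 2 := by positivity
    have hp' : 0 < S.lam ν μ + t ^ 2 := by positivity
    have hsgn : (SignType.sign (1 + t) : ℝ) * (1 + t) = |1 + t| := sign_mul_self _
    have hab : 0 < |1 + t| := abs_pos.2 hT0
    have hsq : √(S.Qm η) * |1 + t| = √(S.Qm μ) * √(S.kap ν μ + t ^ 2) := by
      rw [← Real.sqrt_sq_eq_abs, ← Real.sqrt_mul (hQ η).le, hQs, Real.sqrt_mul hQμ.le]
    have hsη := Real.sqrt_pos.2 (hQ η)
    have hsμ := Real.sqrt_pos.2 hQμ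
    have hsk := Real.sqrt_pos.2 hp
    have hDη := hD η
    have hμν : 0 < μ - ν := sub_pos.2 hνμ
    rw [div_mul_eq_mul_div, div_mul_div_comm, div_mul_div_comm,
      div_eq_div_iff (by positivity) (by positivity)]
    have e1 : S.Dm μ * √(S.Qm μ) * ((S.lam ν μ + t ^ 2) * √(S.kap ν μ + t ^ 2) * (μ - ν))
        = (S.Dm η * (1 + t) ^ 2) * (√(S.Qm η) * |1 + t|) * (μ - ν) := by
      rw [hsq, hDs]; ring
    rw [e1, ← hsgn]
    ring
  · filter_upwards [hsign] with x hx
    simp only [H, hx, Function.comp]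

include hνμ hQ hD hq' hd' in
theorem tendsto_H_atTop (h1 : S.d₁ ≠ S.q₁) : Tendsto (S.H ν μ) atTop (𝓝 (S.HTop ν μ)) := by
  have hlk := lam_ne_kap hνμ hQ hD hq' hd' h1
  have h := (tendsto_bracket (div_pos (hQ ν) (hQ μ)) hlk (S.n + S.m * ν) (S.n + S.m * μ)
    (by norm_num : (1 : ℝ) ^ 2 = 1) tendsto_s₀_atTop tendsto_s₁_atTop).const_mul (S.omega ν μ)
  refine h.congr' ?_
  filter_upwards [eventually_gt_atTop (-1)] with t ht
  rw [H, sign_pos (by linarith : 0 < 1 + t)]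
  simp [kap]

include hνμ hQ hD hq' hd' in
theorem tendsto_H_atBot (h1 : S.d₁ ≠ S.q₁) : Tendsto (S.H ν μ) atBot (𝓝 (S.HBot ν μ)) := by
  have hlk := lam_ne_kap hνμ hQ hD hq' hd' h1
  have h := (tendsto_bracket (div_pos (hQ ν) (hQ μ)) hlk (S.n + S.m * ν) (S.n + S.m * μ)
    (by norm_num : (-1 : ℝ) ^ 2 = 1) tendsto_s₀_atBot tendsto_s₁_atBot).const_mul (-S.omega ν μ)
  refine h.congr' ?_
  filter_upwards [eventually_lt_atBot (-1)] with t ht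
  rw [H, sign_neg (by linarith : 1 + t < 0)]
  simp [kap]

include hνμ in
theorem tendsto_subst_left : Tendsto (subst ν μ) (𝓝[<] μ) atTop := by
  have h1 : Tendsto (fun η => ν - η) (𝓝[<] μ) (𝓝 (ν - μ)) :=
    ((continuous_const.sub continuous_id).tendsto μ).mono_left nhdsWithin_le_nhds
  have h2 : Tendsto (fun η => η - μ) (𝓝[<] μ) (𝓝[<] 0) := by
    refine tendsto_nhdsWithin_iff.2 ⟨?_, ?_⟩
    · have : Tendsto (fun η => η - μ) (𝓝 μ) (𝓝 (μ - μ)) :=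
        (continuous_id.sub continuous_const).tendsto μ
      rw [sub_self] at this
      exact this.mono_left nhdsWithin_le_nhds
    · filter_upwards [self_mem_nhdsWithin] with x hx
      exact sub_neg.2 (mem_Iio.1 hx)
  exact h1.neg_mul_atBot (sub_neg.2 hνμ) (tendsto_inv_nhdsLT_zero.comp h2)

include hνμ in
theorem tendsto_subst_right : Tendsto (subst ν μ) (𝓝[>] μ) atBot := by
  have h1 : Tendsto (fun η => ν - η) (𝓝[>] μ) (𝓝 (ν - μ)) :=
    ((continuous_const.sub continuous_id).tendsto μ).mono_left nhdsWithin_le_nhds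
  have h2 : Tendsto (fun η => η - μ) (𝓝[>] μ) (𝓝[>] 0) := by
    refine tendsto_nhdsWithin_iff.2 ⟨?_, ?_⟩
    · have : Tendsto (fun η => η - μ) (𝓝 μ) (𝓝 (μ - μ)) :=
        (continuous_id.sub continuous_const).tendsto μ
      rw [sub_self] at this
      exact this.mono_left nhdsWithin_le_nhds
    · filter_upwards [self_mem_nhdsWithin] with x hx
      exact sub_pos.2 (mem_Ioi.1 hx)
  exact h1.neg_mul_atTop (sub_neg.2 hνμ) (tendsto_inv_nhdsGT_zero.comp h2)

include hνμ hQ hD hq' hd' in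
theorem integral_rem_of_notMem (h1 : S.d₁ ≠ S.q₁) {a b : ℝ} (h : μ ∉ uIcc a b) :
    ∫ η in a..b, S.rem η = S.H ν μ (subst ν μ b) - S.H ν μ (subst ν μ a) :=
  intervalIntegral.integral_eq_sub_of_hasDerivAt
    (f := fun x => S.H ν μ (subst ν μ x))
    (fun x hx => hasDerivAt_H_subst hνμ hQ hD hq' hd' h1 (by rintro rfl; exact h hx))
    ((continuous_rem hQ hD).intervalIntegrable _ _)

-- As `η` increases to `μ`, the new variable tends to `+∞`, so the boundary value at the pole is the
-- limit of `H` there; approaching from the right gives `-∞`.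
include hνμ hQ hD hq' hd' in
theorem integral_rem_left (h1 : S.d₁ ≠ S.q₁) {a : ℝ} (h : a < μ) :
    ∫ η in a..μ, S.rem η = S.HTop ν μ - S.H ν μ (subst ν μ a) :=
  intervalIntegral.integral_eq_sub_of_hasDerivAt_of_tendsto h
    (f := fun x => S.H ν μ (subst ν μ x))
    (fun _ hx => hasDerivAt_H_subst hνμ hQ hD hq' hd' h1 hx.2.ne)
    ((continuous_rem hQ hD).intervalIntegrable _ _)
    ((hasDerivAt_H_subst hνμ hQ hD hq' hd' h1 h.ne).continuousAt.tendsto.mono_left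
      nhdsWithin_le_nhds)
    ((tendsto_H_atTop hνμ hQ hD hq' hd' h1).comp (tendsto_subst_left hνμ))

include hνμ hQ hD hq' hd' in
theorem integral_rem_right (h1 : S.d₁ ≠ S.q₁) {b : ℝ} (h : μ < b) :
    ∫ η in μ..b, S.rem η = S.H ν μ (subst ν μ b) - S.HBot ν μ :=
  intervalIntegral.integral_eq_sub_of_hasDerivAt_of_tendsto h
    (f := fun x => S.H ν μ (subst ν μ x))
    (fun _ hx => hasDerivAt_H_subst hνμ hQ hD hq' hd' h1 hx.1.ne')
    ((continuous_rem hQ hD).intervalIntegrable _ _)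
    ((tendsto_H_atBot hνμ hQ hD hq' hd' h1).comp (tendsto_subst_right hνμ))
    ((hasDerivAt_H_subst hνμ hQ hD hq' hd' h1 h.ne').continuousAt.tendsto.mono_left
      nhdsWithin_le_nhds)

theorem subst_zero : subst ν μ 0 = -ν / μ := by
  rw [subst, sub_zero, zero_sub, div_neg, neg_div]

theorem subst_one : subst ν μ 1 = -(ν - 1) / (μ - 1) := by
  rw [subst, ← neg_sub μ 1, div_neg, neg_sub, ← neg_div, neg_sub]

include hνμ in
theorem subst_gt {η : ℝ} (h : η < μ) : -1 < subst ν μ η := by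
  have h2 : 0 < (ν - μ) / (η - μ) := div_pos_of_neg_of_neg (sub_neg.2 hνμ) (sub_neg.2 h)
  rw [← one_add_subst h.ne] at h2
  linarith

include hνμ in
theorem subst_lt {η : ℝ} (h : μ < η) : subst ν μ η < -1 := by
  have h2 : (ν - μ) / (η - μ) < 0 := div_neg_of_neg_of_pos (sub_neg.2 hνμ) (sub_pos.2 h)
  rw [← one_add_subst h.ne'] at h2
  linarith

include hνμ in
theorem subst_le_subst {x y : ℝ} (hxy : x ≤ y) (h : 0 < (x - μ) * (y - μ)) :
    subst ν μ x ≤ subst ν μ y := by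
  have hx : x - μ ≠ 0 := left_ne_zero_of_mul h.ne'
  have hy : y - μ ≠ 0 := right_ne_zero_of_mul h.ne'
  have : subst ν μ y - subst ν μ x = (μ - ν) * (y - x) / ((x - μ) * (y - μ)) := by
    rw [subst, subst]; field_simp; ring
  have h2 : 0 ≤ (μ - ν) * (y - x) / ((x - μ) * (y - μ)) :=
    div_nonneg (mul_nonneg (sub_pos.2 hνμ).le (sub_nonneg.2 hxy)) h.le
  linarith

include hνμ hQ hD hq' hd' in
theorem integral_rem_alternatives (h1 : S.d₁ ≠ S.q₁) (h0 : μ ≠ 0) (h1' : μ ≠ 1) (t₀ t₁ : ℝ)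
    (ht₀ : t₀ = min (-ν / μ) (-(ν - 1) / (μ - 1)))
    (ht₁ : t₁ = max (-ν / μ) (-(ν - 1) / (μ - 1))) :
    ((-1 < t₀ ∨ t₁ < -1) ∧ ∫ η in (0 : ℝ)..1, S.rem η = S.H ν μ t₁ - S.H ν μ t₀) ∨
    ((t₀ < -1 ∧ -1 < t₁) ∧ ∫ η in (0 : ℝ)..1, S.rem η =
      S.H ν μ t₀ - S.HBot ν μ + S.HTop ν μ - S.H ν μ t₁) := by
  rw [← subst_zero, ← subst_one] at ht₀ ht₁
  by_cases hin : μ ∈ uIcc (0 : ℝ) 1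
  -- With the pole inside, the images of the endpoints are exchanged: `η = 1` gives the minimum,
  -- below `-1`, and `η = 0` the maximum, above `-1`. The integral is split at `μ`.
  · rw [uIcc_of_le zero_le_one] at hin
    have hlt0 : 0 < μ := lt_of_le_of_ne hin.1 h0.symm
    have hlt1 : μ < 1 := lt_of_le_of_ne hin.2 h1'
    have ha := subst_gt hνμ hlt0
    have hb := subst_lt hνμ hlt1
    rw [min_eq_right (by linarith)] at ht₀
    rw [max_eq_left (by linarith)] at ht₁
    refine Or.inr ⟨⟨ht₀ ▸ hb, ht₁ ▸ ha⟩, ?_⟩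
    rw [← intervalIntegral.integral_add_adjacent_intervals (b := μ)
      ((continuous_rem hQ hD).intervalIntegrable _ _)
      ((continuous_rem hQ hD).intervalIntegrable _ _),
      integral_rem_left hνμ hQ hD hq' hd' h1 hlt0,
      integral_rem_right hνμ hQ hD hq' hd' h1 hlt1, ht₀, ht₁]
    ring
  · have hT := integral_rem_of_notMem hνμ hQ hD hq' hd' h1 hin
    have hcase : μ < 0 ∨ 1 < μ := by
      rw [uIcc_of_le zero_le_one, mem_Icc, not_and_or, not_le, not_le] at hin
      exact hin
    -- On one side of the pole the substitution is increasing, so minimum and maximum are the images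
    -- of `0` and `1` in this order.
    have hle : subst ν μ 0 ≤ subst ν μ 1 := by
      refine subst_le_subst hνμ zero_le_one ?_
      rcases hcase with h | h <;> nlinarith
    rw [min_eq_left hle] at ht₀
    rw [max_eq_right hle] at ht₁
    subst ht₀ ht₁
    refine Or.inl ⟨?_, hT⟩
    rcases hcase with h | h
    · exact Or.inr (subst_lt hνμ (by linarith))
    · exact Or.inl (subst_gt hνμ (by linarith))

end Substitution

/-! ### The degenerate case of equal linear coefficients. -/

section Shift

variable (hQ : ∀ η, 0 < S.Qm η) (hD : ∀ η, 0 < S.Dm η)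

theorem Qm_shift (t : ℝ) : S.Qm (t - S.q₁ / 2) = S.kapShift + t ^ 2 := by
  unfold Qm kapShift; ring

theorem Dm_shift (h : S.d₁ = S.q₁) (t : ℝ) : S.Dm (t - S.q₁ / 2) = S.lamShift + t ^ 2 := by
  unfold Dm lamShift; rw [h]; ring

/-- A translation by `q₁/2` removes both linear terms at once and has no pole. `K` is left free so
that equal and different constant terms are both covered. -/
theorem integral_rem_shift {K : ℝ → ℝ} (hQ : ∀ η, 0 < S.Qm η) (hD : ∀ η, 0 < S.Dm η)
    (h : S.d₁ = S.q₁)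
    (hK : ∀ t, HasDerivAt K ((S.n - S.m * S.q₁ / 2 + S.m * t)
      / ((S.lamShift + t ^ 2) * √(S.kapShift + t ^ 2))) t) :
    ∫ η in (0 : ℝ)..1, S.rem η = K (1 + S.q₁ / 2) - K (S.q₁ / 2) := by
  have hder : ∀ η, HasDerivAt (fun x => K (x + S.q₁ / 2)) (S.rem η) η := by
    intro η
    refine ((hK (η + S.q₁ / 2)).comp_add_const η _).congr_deriv ?_
    rw [← Qm_shift, ← Dm_shift h, add_sub_cancel_right, rem]
    congr 1; ring
  rw [intervalIntegral.integral_eq_sub_of_hasDerivAt (fun x _ => hder x)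
    ((continuous_rem hQ hD).intervalIntegrable _ _), zero_add]

include hQ in
theorem kapShift_pos : 0 < S.kapShift := by
  have := Qm_shift (S := S) 0
  rw [zero_pow two_ne_zero, add_zero] at this
  exact this ▸ hQ _

include hD in
theorem lamShift_pos (h : S.d₁ = S.q₁) : 0 < S.lamShift := by
  have := Dm_shift h 0
  rw [zero_pow two_ne_zero, add_zero] at this
  exact this ▸ hD _

include hQ hD in
theorem integral_rem_HShift (h : S.d₁ = S.q₁) (h0 : S.d₀ ≠ S.q₀) :
    ∫ η in (0 : ℝ)..1, S.rem η = S.HShift (1 + S.q₁ / 2) - S.HShift (S.q₁ / 2) := by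
  refine integral_rem_shift hQ hD h fun t => ?_
  refine hasDerivAt_bracket (lamShift_pos hD h) (kapShift_pos hQ) ?_ _ _ t
  intro h'
  unfold lamShift kapShift at h'
  rw [h] at h'
  exact h0 (by linarith)

include hQ hD in
theorem integral_rem_HProp (h : S.d₁ = S.q₁) (h0 : S.d₀ = S.q₀) :
    ∫ η in (0 : ℝ)..1, S.rem η = S.HProp (1 + S.q₁ / 2) - S.HProp (S.q₁ / 2) := by
  refine integral_rem_shift hQ hD h fun t => ?_
  have hk := kapShift_pos hQ
  -- The quadratics now coincide, so the integrand has denominator `(ϰ + t²)^(3/2)`, and `s₀` is an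
  -- antiderivative up to the factor `ϰ`.
  have hlk : S.lamShift = S.kapShift := by unfold lamShift kapShift; rw [h, h0]
  have hp : 0 < S.kapShift + t ^ 2 := by positivity
  have h1 := hasDerivAt_G_s₁ hk hk t
  rw [sub_self] at h1
  refine (((hasDerivAt_s₀ hk t).const_mul ((S.n - S.m * S.q₁ / 2) / S.kapShift)).add
    (h1.const_mul S.m)).congr_deriv ?_
  have hs := Real.sqrt_pos.2 hp
  rw [hlk]
  field_simp

end Shift

end Params

/-! ### Integration of the cubed reciprocal distance along a line. -/

section LineIntegral

variable {A B : E3}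

/-- Multiplied by `|A|²`, the Gram determinant is the squared length of `|A|² B - (A · B) A`, a
nontrivial combination of independent vectors. -/
theorem gram_pos (h : ∀ a b : ℝ, a • A + b • B = 0 → a = 0 ∧ b = 0) :
    0 < ‖A‖ ^ 2 * ‖B‖ ^ 2 - ⟪A, B⟫ ^ 2 := by
  have hA : A ≠ 0 := fun hA => one_ne_zero (h 1 0 (by simp [hA])).1
  have hA2 : 0 < ‖A‖ ^ 2 := by positivity
  have hne : ‖A‖ ^ 2 • B + (-⟪A, B⟫) • A ≠ 0 := fun h0 =>
    hA2.ne' (h (-⟪A, B⟫) (‖A‖ ^ 2) (by rw [add_comm]; exact h0)).2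
  have h1 : 0 < ‖‖A‖ ^ 2 • B + (-⟪A, B⟫) • A‖ ^ 2 := by positivity
  have h2 : ‖‖A‖ ^ 2 • B + (-⟪A, B⟫) • A‖ ^ 2
      = ‖A‖ ^ 2 * (‖A‖ ^ 2 * ‖B‖ ^ 2 - ⟪A, B⟫ ^ 2) := by
    rw [norm_add_sq_real, norm_smul, norm_smul, inner_smul_left, inner_smul_right,
      real_inner_comm A B, mul_pow, mul_pow, Real.norm_eq_abs, Real.norm_eq_abs, sq_abs, sq_abs]
    simp only [conj_trivial]
    ring
  rw [h2] at h1
  exact pos_of_mul_pos_right h1 hA2.le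

theorem norm_smul_add_sq (A B : E3) (x : ℝ) :
    ‖x • A + B‖ ^ 2 = ‖A‖ ^ 2 * x ^ 2 + 2 * ⟪A, B⟫ * x + ‖B‖ ^ 2 := by
  rw [norm_add_sq_real, norm_smul, inner_smul_left, mul_pow, Real.norm_eq_abs, sq_abs]
  simp only [conj_trivial]
  ring

/-- The numerator of the antiderivative of `(a + b x) / ‖x A + B‖³`. -/
def lineNum (A B : E3) (a b x : ℝ) : ℝ :=
  (a * ‖A‖ ^ 2 - b * ⟪A, B⟫) * x + a * ⟪A, B⟫ - b * ‖B‖ ^ 2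

/-- With `R = |xA + B|²` and `L` the numerator, `L' R - L R' / 2` equals the Gram determinant times
`a + b x`: the quadratic terms cancel. -/
theorem hasDerivAt_line (h : ∀ a b : ℝ, a • A + b • B = 0 → a = 0 ∧ b = 0) (a b x : ℝ) :
    HasDerivAt (fun x => lineNum A B a b x
      / ((‖A‖ ^ 2 * ‖B‖ ^ 2 - ⟪A, B⟫ ^ 2) * ‖x • A + B‖)) ((a + b * x) / ‖x • A + B‖ ^ 3) x := by
  have hD := gram_pos h
  have hne : x • A + B ≠ 0 := fun h0 => one_ne_zero (h x 1 (by rw [one_smul]; exact h0)).2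
  have hN : 0 < ‖x • A + B‖ := norm_pos_iff.2 hne
  have h2 := norm_smul_add_sq A B x
  have hR : HasDerivAt (fun x : ℝ => ‖A‖ ^ 2 * x ^ 2 + 2 * ⟪A, B⟫ * x + ‖B‖ ^ 2)
      (2 * ‖A‖ ^ 2 * x + 2 * ⟪A, B⟫) x := by
    refine ((((hasDerivAt_pow 2 x).const_mul (‖A‖ ^ 2)).add
      ((hasDerivAt_id x).const_mul (2 * ⟪A, B⟫))).add_const (‖B‖ ^ 2)).congr_deriv ?_
    simp; ring
  have hS : HasDerivAt (fun x : ℝ => ‖x • A + B‖) ((‖A‖ ^ 2 * x + ⟪A, B⟫) / ‖x • A + B‖) x := by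
    have h3 := hR.sqrt (by rw [← h2]; positivity)
    have h4 : (fun x : ℝ => ‖x • A + B‖)
        = fun x => √(‖A‖ ^ 2 * x ^ 2 + 2 * ⟪A, B⟫ * x + ‖B‖ ^ 2) := by
      funext y; rw [← norm_smul_add_sq, Real.sqrt_sq (norm_nonneg _)]
    rw [h4]
    refine h3.congr_deriv ?_
    rw [← h2, Real.sqrt_sq hN.le]
    field_simp
  have hL : HasDerivAt (lineNum A B a b) (a * ‖A‖ ^ 2 - b * ⟪A, B⟫) x := by
    refine ((((hasDerivAt_id x).const_mul (a * ‖A‖ ^ 2 - b * ⟪A, B⟫)).add_const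
      (a * ⟪A, B⟫)).sub_const (b * ‖B‖ ^ 2)).congr_deriv (mul_one _)
  refine (hL.div (hS.const_mul (‖A‖ ^ 2 * ‖B‖ ^ 2 - ⟪A, B⟫ ^ 2))
    (by positivity)).congr_deriv ?_
  generalize ‖x • A + B‖ = N at *
  rw [lineNum]
  field_simp
  rw [h2]
  ring

/-- The formula also holds for `k = 0`, which is needed at `η₃ = 0`. The term `0 • A` is kept so
that both endpoints have the same shape as the two columns of the tables. -/
theorem integral_line (h : ∀ a b : ℝ, a • A + b • B = 0 → a = 0 ∧ b = 0) (a b k : ℝ) :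
    ∫ t in (0 : ℝ)..1, k * (a + b * (k * t)) / ‖(k * t) • A + B‖ ^ 3 =
      lineNum A B a b k / ((‖A‖ ^ 2 * ‖B‖ ^ 2 - ⟪A, B⟫ ^ 2) * ‖k • A + B‖)
        - lineNum A B a b 0 / ((‖A‖ ^ 2 * ‖B‖ ^ 2 - ⟪A, B⟫ ^ 2) * ‖(0 : ℝ) • A + B‖) := by
  have hder : ∀ t : ℝ, HasDerivAt (fun t => lineNum A B a b (k * t)
      / ((‖A‖ ^ 2 * ‖B‖ ^ 2 - ⟪A, B⟫ ^ 2) * ‖(k * t) • A + B‖))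
      (k * (a + b * (k * t)) / ‖(k * t) • A + B‖ ^ 3) t := by
    intro t
    have hk : HasDerivAt (fun t : ℝ => k * t) k t := by
      simpa using (hasDerivAt_id t).const_mul k
    exact ((hasDerivAt_line h a b (k * t)).comp t hk).congr_deriv (by ring)
  have hcont : Continuous fun t : ℝ => k * (a + b * (k * t)) / ‖(k * t) • A + B‖ ^ 3 := by
    refine Continuous.div (by fun_prop) (by fun_prop) fun t => ?_
    have hne : (k * t) • A + B ≠ 0 := fun h0 =>
      one_ne_zero (h (k * t) 1 (by rw [one_smul]; exact h0)).2
    positivity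
  rw [intervalIntegral.integral_eq_sub_of_hasDerivAt (fun t _ => hder t)
    (hcont.intervalIntegrable _ _)]
  simp only [mul_one, mul_zero]

end LineIntegral

/-! ### The coefficient tables and the integration over `η₄`. -/

/-- The integrand number `i + 1` is `k (a + b k η₄) / ‖k η₄ A + B‖³` with `A = edgeDir`. -/
def edgeDir (u v w : E3) : Fin 5 → E3 := ![w, u + v, v + w, u, v + w]

/-- The vector `B` of the integrand `k (a + b k η₄) / ‖k η₄ A + B‖³`. -/
def edgeBase (u v w : E3) (η : ℝ) : Fin 5 → E3 :=
  ![η • (u + v) - u, w - η • u, u - η • w, η • (v + w) - w, η • u - w]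

/-- The factor `k` of the integrand `k (a + b k η₄) / ‖k η₄ A + B‖³`. -/
def edgeStep (η : ℝ) : Fin 5 → ℝ := ![1, η, η, η, η]

/-- The constant `a` of the integrand `k (a + b k η₄) / ‖k η₄ A + B‖³`. -/
def edgeConst (c₀ c₂ η : ℝ) : Fin 5 → ℝ :=
  ![0, c₀ + c₂ * η, η * (c₀ + c₂), (1 - η) * c₀, c₀ + c₂ * η]

/-- The slope `b` of the integrand `k (a + b k η₄) / ‖k η₄ A + B‖³`. -/
def edgeSlope (c₀ c₁ c₂ η : ℝ) : Fin 5 → ℝ :=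
  ![c₀ + c₁ * η + c₂ * (1 - η), c₁ - c₂, -(c₀ + c₂), (1 - η) * c₂, -(c₀ + c₂ * η)]

theorem edgeIntegrand_eq (u v w : E3) (c₀ c₁ c₂ : ℝ) (i : Fin 5) (η t : ℝ) :
    edgeIntegrand u v w c₀ c₁ c₂ i (η, t) =
      edgeStep η i * (edgeConst c₀ c₂ η i + edgeSlope c₀ c₁ c₂ η i * (edgeStep η i * t))
        / ‖(edgeStep η i * t) • edgeDir u v w i + edgeBase u v w η i‖ ^ 3 := by
  have e1 : η • (u + v) + t • w - u = (1 * t) • w + (η • (u + v) - u) := by module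
  have e2 : (η * t) • (u + v) - η • u + w = (η * t) • (u + v) + (w - η • u) := by module
  have e3 : (η * t) • (w + v) - η • w + u = (η * t) • (v + w) + (u - η • w) := by module
  have e4 : (η * t) • u + η • (w + v) - w = (η * t) • u + (η • (v + w) - w) := by module
  have e5 : (η * t) • (w + v) + η • u - w = (η * t) • (v + w) + (η • u - w) := by module
  fin_cases i <;>
    simp only [edgeIntegrand, edgeStep, edgeConst, edgeSlope, edgeDir, edgeBase, e1, e2, e3, e4,
      e5, Fin.zero_eta, Fin.mk_one, Fin.reduceFinMk, Matrix.cons_val] <;> ring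

section Tables

variable {u v w : E3} (hli : ∀ a b c : ℝ, a • u + b • v + c • w = 0 → a = 0 ∧ b = 0 ∧ c = 0)

include hli in
theorem edge_independent (i : Fin 5) (η a b : ℝ)
    (h : a • edgeDir u v w i + b • edgeBase u v w η i = 0) : a = 0 ∧ b = 0 := by
  fin_cases i <;> simp [edgeDir, edgeBase] at h
  · obtain ⟨h1, h2, h3⟩ := hli (b * η - b) (b * η) a (by rw [← h]; module)
    exact ⟨h3, by linarith⟩
  · obtain ⟨h1, h2, h3⟩ := hli (a - b * η) a b (by rw [← h]; module)
    exact ⟨h2, h3⟩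
  · obtain ⟨h1, h2, h3⟩ := hli b a (a - b * η) (by rw [← h]; module)
    exact ⟨h2, h1⟩
  · obtain ⟨h1, h2, h3⟩ := hli a (b * η) (b * η - b) (by rw [← h]; module)
    exact ⟨h1, by linarith⟩
  · obtain ⟨h1, h2, h3⟩ := hli (b * η) a (a - b) (by rw [← h]; module)
    exact ⟨h2, by linarith⟩

include hli in
theorem tabQ_pos (i : Fin 5) (j : Fin 2) : 0 < tabQ u v w i j := by
  have hne : ∀ a b c : ℝ, (a ≠ 0 ∨ b ≠ 0 ∨ c ≠ 0) → 0 < ‖a • u + b • v + c • w‖ ^ 2 := by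
    intro a b c h
    have : a • u + b • v + c • w ≠ 0 := fun h0 => by
      obtain ⟨h1, h2, h3⟩ := hli a b c h0
      simp [h1, h2, h3] at h
    positivity
  have e1 := hne 1 0 0 (by simp)
  have e2 := hne 0 1 0 (by simp)
  have e3 := hne 0 0 1 (by simp)
  have e4 := hne 1 1 0 (by simp)
  have e5 := hne 0 1 1 (by simp)
  have e6 := hne 1 1 1 (by simp)
  simp only [one_smul, zero_smul, add_zero, zero_add] at e1 e2 e3 e4 e5 e6
  fin_cases i <;> fin_cases j <;> simp [tabQ] <;> assumption

include hli in
theorem tabD_pos (i : Fin 5) : 0 < tabD u v w i := by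
  have e1 : 0 < ‖u + v‖ ^ 2 * ‖w‖ ^ 2 - ⟪u + v, w⟫ ^ 2 := gram_pos fun a b h => by
    obtain ⟨h1, h2, h3⟩ := hli a a b (by rw [← h]; module)
    exact ⟨h1, h3⟩
  have e2 : 0 < ‖u‖ ^ 2 * ‖v‖ ^ 2 - ⟪u, v⟫ ^ 2 := gram_pos fun a b h => by
    obtain ⟨h1, h2, h3⟩ := hli a b 0 (by rw [← h]; module)
    exact ⟨h1, h2⟩
  have e3 : 0 < ‖v‖ ^ 2 * ‖w‖ ^ 2 - ⟪v, w⟫ ^ 2 := gram_pos fun a b h => by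
    obtain ⟨h1, h2, h3⟩ := hli 0 a b (by rw [← h]; module)
    exact ⟨h2, h3⟩
  have e4 : 0 < ‖v + w‖ ^ 2 * ‖u‖ ^ 2 - ⟪v + w, u⟫ ^ 2 := gram_pos fun a b h => by
    obtain ⟨h1, h2, h3⟩ := hli b a a (by rw [← h]; module)
    exact ⟨h2, h1⟩
  rw [mul_comm (‖v + w‖ ^ 2)] at e4
  fin_cases i <;> simp only [tabD] <;> assumption

theorem tables_D (u v w : E3) (i : Fin 5) (η : ℝ) :
    tabD₀ u v w i + 2 * tabD₁ u v w i * η + tabD u v w i * η ^ 2 =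
      ‖edgeDir u v w i‖ ^ 2 * ‖edgeBase u v w η i‖ ^ 2
        - ⟪edgeDir u v w i, edgeBase u v w η i⟫ ^ 2 := by
  fin_cases i <;>
    simp [tabD₀, tabD₁, tabD, edgeDir, edgeBase] <;>
    -- Everything is expanded into the six inner products of `u, v, w`, with the order of arguments
    -- fixed, so that a polynomial identity remains.
    simp only [← real_inner_self_eq_norm_sq, inner_add_left, inner_add_right, inner_sub_left,
      inner_sub_right, inner_smul_left, inner_smul_right, conj_trivial,
      real_inner_comm u v, real_inner_comm u w, real_inner_comm v w] <;>
    ring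

theorem tables_Q (u v w : E3) (i : Fin 5) (j : Fin 2) (η : ℝ) :
    tabQ₀ u w i j + 2 * tabQ₁ u v w i j * η + tabQ u v w i j * η ^ 2 =
      ‖(![0, edgeStep η i] j : ℝ) • edgeDir u v w i + edgeBase u v w η i‖ ^ 2 := by
  fin_cases i <;> fin_cases j <;>
    simp [tabQ₀, tabQ₁, tabQ, edgeDir, edgeBase, edgeStep] <;>
    simp only [← real_inner_self_eq_norm_sq, inner_add_left, inner_add_right, inner_sub_left,
      inner_sub_right, inner_smul_left, inner_smul_right, conj_trivial,
      real_inner_comm u v, real_inner_comm u w, real_inner_comm v w] <;>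
    ring

theorem tables_P (u v w : E3) (c₀ c₁ c₂ : ℝ) (i : Fin 5) (j : Fin 2) (η : ℝ) :
    (edgeParams u v w c₀ c₁ c₂ i j).P η =
      lineNum (edgeDir u v w i) (edgeBase u v w η i) (edgeConst c₀ c₂ η i)
        (edgeSlope c₀ c₁ c₂ η i) (![0, edgeStep η i] j) := by
  fin_cases i <;> fin_cases j <;>
    simp [Params.P, edgeParams, tabP₀, tabP₁, tabP₂, tabP₃, lineNum, edgeDir, edgeBase, edgeStep,
      edgeConst, edgeSlope] <;>
    simp only [← real_inner_self_eq_norm_sq, inner_add_left, inner_add_right, inner_sub_left,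
      inner_sub_right, inner_smul_left, inner_smul_right, conj_trivial,
      real_inner_comm u v, real_inner_comm u w, real_inner_comm v w] <;>
    ring

end Tables

section Slices

variable {u v w : E3} (hli : ∀ a b c : ℝ, a • u + b • v + c • w = 0 → a = 0 ∧ b = 0 ∧ c = 0)
  (c₀ c₁ c₂ : ℝ)

include hli

theorem edgeParams_Q (i : Fin 5) (j : Fin 2) (η : ℝ) : (edgeParams u v w c₀ c₁ c₂ i j).Q η =
    ‖(![0, edgeStep η i] j : ℝ) • edgeDir u v w i + edgeBase u v w η i‖ ^ 2 := by
  rw [← tables_Q]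
  have := (tabQ_pos hli i j).ne'
  simp only [Params.Q, Params.Qm, edgeParams]
  field_simp

theorem edgeParams_d_mul_Dm (i : Fin 5) (j : Fin 2) (η : ℝ) :
    (edgeParams u v w c₀ c₁ c₂ i j).d * (edgeParams u v w c₀ c₁ c₂ i j).Dm η =
      ‖edgeDir u v w i‖ ^ 2 * ‖edgeBase u v w η i‖ ^ 2
        - ⟪edgeDir u v w i, edgeBase u v w η i⟫ ^ 2 := by
  rw [← tables_D]
  have := (tabD_pos hli i).ne'
  simp only [Params.Dm, edgeParams]
  field_simp

theorem edgeParams_Qm_pos (i : Fin 5) (j : Fin 2) (η : ℝ) :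
    0 < (edgeParams u v w c₀ c₁ c₂ i j).Qm η := by
  refine pos_of_mul_pos_right (a := (edgeParams u v w c₀ c₁ c₂ i j).q) ?_ (tabQ_pos hli i j).le
  change 0 < (edgeParams u v w c₀ c₁ c₂ i j).Q η
  rw [edgeParams_Q hli]
  have : (![0, edgeStep η i] j : ℝ) • edgeDir u v w i + edgeBase u v w η i ≠ 0 := fun h0 =>
    one_ne_zero (edge_independent hli i η (![0, edgeStep η i] j) 1 (by rw [one_smul]; exact h0)).2
  positivity

theorem edgeParams_Dm_pos (i : Fin 5) (j : Fin 2) (η : ℝ) :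
    0 < (edgeParams u v w c₀ c₁ c₂ i j).Dm η := by
  refine pos_of_mul_pos_right (a := (edgeParams u v w c₀ c₁ c₂ i j).d) ?_ (tabD_pos hli i).le
  rw [edgeParams_d_mul_Dm hli]
  exact gram_pos fun a b h => edge_independent hli i η a b h

theorem edgeParams_h (i : Fin 5) (j : Fin 2) (η : ℝ) :
    (edgeParams u v w c₀ c₁ c₂ i j).h η =
      lineNum (edgeDir u v w i) (edgeBase u v w η i) (edgeConst c₀ c₂ η i)
        (edgeSlope c₀ c₁ c₂ η i) (![0, edgeStep η i] j) /
      ((‖edgeDir u v w i‖ ^ 2 * ‖edgeBase u v w η i‖ ^ 2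
        - ⟪edgeDir u v w i, edgeBase u v w η i⟫ ^ 2) *
      ‖(![0, edgeStep η i] j : ℝ) • edgeDir u v w i + edgeBase u v w η i‖) := by
  rw [Params.h, tables_P, edgeParams_Q hli, Real.sqrt_sq (norm_nonneg _), Params.D,
    mul_assoc 4, edgeParams_d_mul_Dm hli, mul_assoc 4, mul_div_mul_left _ _ four_ne_zero]

theorem integral_edgeIntegrand_slice (i : Fin 5) (η : ℝ) :
    ∫ t in (0 : ℝ)..1, edgeIntegrand u v w c₀ c₁ c₂ i (η, t) =
      (edgeParams u v w c₀ c₁ c₂ i 1).h η - (edgeParams u v w c₀ c₁ c₂ i 0).h η := by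
  simp_rw [edgeIntegrand_eq]
  rw [integral_line (fun a b h => edge_independent hli i η a b h), edgeParams_h hli,
    edgeParams_h hli]
  rfl

theorem edgeParams_continuous_h (i : Fin 5) (j : Fin 2) :
    Continuous (edgeParams u v w c₀ c₁ c₂ i j).h :=
  Params.continuous_h (tabQ_pos hli i j) (tabD_pos hli i) (edgeParams_Qm_pos hli c₀ c₁ c₂ i j)
    (edgeParams_Dm_pos hli c₀ c₁ c₂ i j)

theorem edgeIntegral_eq (i : Fin 5)
    (hint : IntegrableOn (edgeIntegrand u v w c₀ c₁ c₂ i) (Ioo (0 : ℝ) 1 ×ˢ Ioo (0 : ℝ) 1)) :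
    edgeIntegral u v w c₀ c₁ c₂ i =
      (∫ η in (0 : ℝ)..1, (edgeParams u v w c₀ c₁ c₂ i 1).h η)
        - ∫ η in (0 : ℝ)..1, (edgeParams u v w c₀ c₁ c₂ i 0).h η := by
  have hc := edgeParams_continuous_h hli c₀ c₁ c₂ i
  rw [edgeIntegral, Measure.volume_eq_prod, setIntegral_prod _ hint,
    ← intervalIntegral.integral_sub ((hc 1).intervalIntegrable _ _)
      ((hc 0).intervalIntegrable _ _), intervalIntegral.integral_of_le zero_le_one,
    integral_Ioc_eq_integral_Ioo]
  refine integral_congr_ae (Eventually.of_forall fun η => ?_)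
  simp only
  rw [← integral_edgeIntegrand_slice hli, intervalIntegral.integral_of_le zero_le_one,
    integral_Ioc_eq_integral_Ioo]

end Slices

/-! ### The closed form for general parameters. -/

theorem Params.closed_form {S : Params} (hq : 0 < S.q) (hd : 0 < S.d) (hQ : ∀ η, 0 < S.Qm η)
    (hD : ∀ η, 0 < S.Dm η) :
    0 < S.q ∧ 0 < S.d ∧ (∀ η, 0 < S.Q η) ∧ (∀ η, 0 < S.D η) ∧
        IntervalIntegrable S.h volume 0 1 ∧
        (∀ η, S.h η = 1 / (S.d * √(S.Q η)) *
          (S.p₂ - S.d₁ * S.p₃ + S.p₃ * η + (S.n + S.m * η) / S.Dm η)) ∧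
        (S.d₁ ≠ S.q₁ → ∃ ν μ : ℝ, ν < μ ∧
          (∀ z : ℝ, (S.d₁ - S.q₁) * z ^ 2 + 2 * (S.d₀ - S.q₀) * z
              + (S.q₁ * S.d₀ - S.d₁ * S.q₀) = 0 ↔ z = ν ∨ z = μ) ∧
          (∀ η, η ≠ μ → HasDerivAt (fun x => S.H ν μ (DoubleLayer.subst ν μ x))
            ((S.n + S.m * η) / (S.Dm η * √(S.Qm η))) η) ∧
          Tendsto (S.H ν μ) atTop (𝓝 (S.HTop ν μ)) ∧
          Tendsto (S.H ν μ) atBot (𝓝 (S.HBot ν μ)) ∧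
          (μ ≠ 0 → μ ≠ 1 → ∀ t₀ t₁ : ℝ,
            t₀ = min (-ν / μ) (-(ν - 1) / (μ - 1)) →
            t₁ = max (-ν / μ) (-(ν - 1) / (μ - 1)) →
            ((-1 < t₀ ∨ t₁ < -1) ∧
              ∫ η in (0 : ℝ)..1, S.h η =
                1 / (S.d * √S.q) * (S.E 1 - S.E 0 + (S.H ν μ t₁ - S.H ν μ t₀))) ∨
            ((t₀ < -1 ∧ -1 < t₁) ∧
              ∫ η in (0 : ℝ)..1, S.h η =
                1 / (S.d * √S.q) * (S.E 1 - S.E 0 +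
                  (S.H ν μ t₀ - S.HBot ν μ + S.HTop ν μ - S.H ν μ t₁)))) ∧
          (μ = 0 → ∫ η in (0 : ℝ)..1, S.h η =
            1 / (S.d * √S.q) * (S.E 1 - S.E 0 + (S.H ν μ (ν - 1) - S.HBot ν μ))) ∧
          (μ = 1 → ∫ η in (0 : ℝ)..1, S.h η =
            1 / (S.d * √S.q) * (S.E 1 - S.E 0 + (S.HTop ν μ - S.H ν μ (-ν))))) ∧
        (S.d₁ = S.q₁ → S.d₀ ≠ S.q₀ → ∫ η in (0 : ℝ)..1, S.h η =
          1 / (S.d * √S.q) * (S.E 1 - S.E 0 +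
            (S.HShift (1 + S.q₁ / 2) - S.HShift (S.q₁ / 2)))) ∧
        (S.d₁ = S.q₁ → S.d₀ = S.q₀ → ∫ η in (0 : ℝ)..1, S.h η =
          1 / (S.d * √S.q) * (S.E 1 - S.E 0 +
            (S.HProp (1 + S.q₁ / 2) - S.HProp (S.q₁ / 2)))) := by
  have hint := integral_h hq hd hQ hD
  refine ⟨hq, hd, fun η => mul_pos hq (hQ η), fun η => mul_pos (mul_pos four_pos hd) (hD η),
    (continuous_h hq hd hQ hD).intervalIntegrable _ _, h_eq hq hd hQ hD, fun h1 => ?_,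
    fun h1 h0 => by rw [hint, integral_rem_HShift hQ hD h1 h0],
    fun h1 h0 => by rw [hint, integral_rem_HProp hQ hD h1 h0]⟩
  obtain ⟨ν, μ, hνμ, hz, hq', hd'⟩ := exists_roots hQ h1
  refine ⟨ν, μ, hνμ, hz, fun η hη => hasDerivAt_H_subst hνμ hQ hD hq' hd' h1 hη,
    tendsto_H_atTop hνμ hQ hD hq' hd' h1, tendsto_H_atBot hνμ hQ hD hq' hd' h1,
    fun h0 h1' t₀ t₁ ht₀ ht₁ => ?_, fun h0 => ?_, fun h0 => ?_⟩
  · rcases integral_rem_alternatives hνμ hQ hD hq' hd' h1 h0 h1' t₀ t₁ ht₀ ht₁ with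
      ⟨h, e⟩ | ⟨h, e⟩
    · exact Or.inl ⟨h, by rw [hint, e]⟩
    · exact Or.inr ⟨h, by rw [hint, e]⟩
  · subst h0
    rw [hint, integral_rem_right hνμ hQ hD hq' hd' h1 one_pos, subst_one,
      show -(ν - 1) / (0 - 1) = ν - 1 by ring]
  · subst h0
    rw [hint, integral_rem_left hνμ hQ hD hq' hd' h1 one_pos, subst_zero, div_one]

/-! ### Changes of variables over the reference triangle. -/

/-- The open unit square. -/
def unitSquare : Set (ℝ × ℝ) := Ioo (0 : ℝ) 1 ×ˢ Ioo (0 : ℝ) 1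

theorem measurableSet_unitSquare : MeasurableSet unitSquare :=
  measurableSet_Ioo.prod measurableSet_Ioo

theorem lintegral_Ioo_scale {c : ℝ} (hc : 0 < c) (g : ℝ → ℝ≥0∞) :
    ∫⁻ x in Ioo 0 c, g x = ∫⁻ s in Ioo (0 : ℝ) 1, ENNReal.ofReal c * g (c * s) := by
  have h := lintegral_image_eq_lintegral_abs_deriv_mul (f := fun s => c * s) (f' := fun _ => c)
    (s := Ioo (0 : ℝ) 1) measurableSet_Ioo
    (fun x _ => by simpa using ((hasDerivAt_id x).const_mul c).hasDerivWithinAt)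
    (mul_right_injective₀ hc.ne').injOn g
  rw [image_mul_left_Ioo hc] at h
  simpa [abs_of_pos hc] using h

/-- The Duffy transformation of the open unit square onto `{0 < r < t < a}`. -/
theorem lintegral_duffy {a : ℝ} (ha : 0 < a) {g : ℝ × ℝ → ℝ≥0∞} (hg : Measurable g) :
    ∫⁻ z in {z : ℝ × ℝ | 0 < z.2 ∧ z.2 < z.1 ∧ z.1 < a}, g z =
      ∫⁻ η in unitSquare, ENNReal.ofReal (a ^ 2 * η.1) * g (a * η.1, a * η.1 * η.2) := by
  have hS : MeasurableSet {z : ℝ × ℝ | 0 < z.2 ∧ z.2 < z.1 ∧ z.1 < a} := by measurability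
  have hL : ∫⁻ z in {z : ℝ × ℝ | 0 < z.2 ∧ z.2 < z.1 ∧ z.1 < a}, g z =
      ∫⁻ t in Ioo 0 a, ∫⁻ r in Ioo 0 t, g (t, r) := by
    rw [← lintegral_indicator hS, Measure.volume_eq_prod,
      lintegral_prod _ (hg.indicator hS).aemeasurable, ← lintegral_indicator measurableSet_Ioo]
    refine lintegral_congr fun t => ?_
    by_cases ht : t ∈ Ioo 0 a
    · rw [indicator_of_mem ht, ← lintegral_indicator measurableSet_Ioo]
      refine lintegral_congr fun r => ?_
      simp only [indicator, mem_ofPred_eq, mem_Ioo]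
      congr 1
      simp [ht.2]
    · rw [indicator_of_notMem ht]
      refine (lintegral_congr (g := fun _ => 0) fun r => indicator_of_notMem (fun h => ht ?_) _).trans
        lintegral_zero
      exact ⟨h.1.trans h.2.1, h.2.2⟩
  rw [hL, lintegral_Ioo_scale ha, unitSquare, Measure.volume_eq_prod, ← Measure.prod_restrict,
    lintegral_prod _ (by fun_prop)]
  refine setLIntegral_congr_fun measurableSet_Ioo fun s hs => ?_
  simp only
  rw [lintegral_Ioo_scale (mul_pos ha hs.1), ← lintegral_const_mul _ (by fun_prop)]
  refine lintegral_congr fun q => ?_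
  rw [← mul_assoc, ← ENNReal.ofReal_mul ha.le]
  congr 2; ring

theorem lintegral_square {a : ℝ} (ha : 0 < a) {g : ℝ × ℝ → ℝ≥0∞} (hg : Measurable g) :
    ∫⁻ z in Ioo 0 a ×ˢ Ioo 0 a, g z =
      ∫⁻ η in unitSquare, ENNReal.ofReal (a ^ 2) * g (a * η.1, a * η.2) := by
  rw [unitSquare, Measure.volume_eq_prod, ← Measure.prod_restrict, ← Measure.prod_restrict,
    lintegral_prod _ hg.aemeasurable, lintegral_prod _ (by fun_prop), lintegral_Ioo_scale ha]
  refine lintegral_congr fun s => ?_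
  rw [lintegral_Ioo_scale ha, ← lintegral_const_mul _ (by fun_prop)]
  refine lintegral_congr fun q => ?_
  rw [← mul_assoc, ← ENNReal.ofReal_mul ha.le, sq]

/-- A family of changes of variables in the fibres, assembled over the reference triangle. -/
theorem measurePreserving_fibrewise {δ : ℝ × (ℝ × ℝ) → ℝ × ℝ} (hδ : Measurable δ)
    {ρ : ℝ × (ℝ × ℝ) → ℝ≥0} (hρ : Measurable ρ) {W : ℝ → Set (ℝ × ℝ)}
    (hW : MeasurableSet {z : ℝ × (ℝ × ℝ) | z.2 ∈ W z.1})
    (h : ∀ a, 0 < a → ∀ g : ℝ × ℝ → ℝ≥0∞, Measurable g →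
      ∫⁻ z in W a, g z = ∫⁻ η in unitSquare, ρ (a, η) * g (δ (a, η))) :
    MeasurePreserving (fun z : (ℝ × ℝ) × (ℝ × ℝ) => (z.1, δ (z.1.2, z.2)))
      ((volume.restrict (refTriangle ×ˢ unitSquare)).withDensity
        fun z => (ρ (z.1.2, z.2) : ℝ≥0∞))
      (volume.restrict {z | z.1 ∈ refTriangle ∧ z.2 ∈ W z.1.2}) := by
  have hm : Measurable fun z : (ℝ × ℝ) × (ℝ × ℝ) => (z.1, δ (z.1.2, z.2)) := by fun_prop
  have hS : MeasurableSet {z : (ℝ × ℝ) × (ℝ × ℝ) | z.1 ∈ refTriangle ∧ z.2 ∈ W z.1.2} := by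
    refine (measurable_fst measurableSet_refTriangle).inter ?_
    exact (by fun_prop : Measurable fun z : (ℝ × ℝ) × (ℝ × ℝ) => (z.1.2, z.2)) hW
  -- Testing against nonnegative functions allows Tonelli without integrability, and the fibre
  -- hypothesis applies for each fixed base point.
  refine ⟨hm, Measure.ext_of_lintegral _ fun f hf => ?_⟩
  rw [lintegral_map hf hm, lintegral_withDensity_eq_lintegral_mul _ (by fun_prop) (by fun_prop),
    Measure.volume_eq_prod, ← Measure.prod_restrict, lintegral_prod _ (by fun_prop),
    ← lintegral_indicator hS, lintegral_prod _ (hf.indicator hS).aemeasurable,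
    ← lintegral_indicator measurableSet_refTriangle]
  refine lintegral_congr fun x => ?_
  by_cases hx : x ∈ refTriangle
  · have hWx : MeasurableSet (W x.2) := measurable_prodMk_left (x := x.2) hW
    rw [indicator_of_mem hx]
    have := h x.2 hx.2.2.1 (fun z => f (x, z)) (by fun_prop)
    simp only [Pi.mul_apply]
    rw [← this, ← lintegral_indicator hWx]
    refine lintegral_congr fun z => ?_
    by_cases hz : z ∈ W x.2
    · rw [indicator_of_mem hz, indicator_of_mem (by exact ⟨hx, hz⟩)]
    · rw [indicator_of_notMem hz, indicator_of_notMem fun h => hz h.2]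
  · rw [indicator_of_notMem hx]
    symm
    simp [indicator, hx]

/-- The Duffy transformation over the reference triangle. -/
theorem measurePreserving_duffy :
    MeasurePreserving
      (fun z : (ℝ × ℝ) × (ℝ × ℝ) => (z.1, (z.1.2 * z.2.1, z.1.2 * z.2.1 * z.2.2)))
      ((volume.restrict (refTriangle ×ˢ unitSquare)).withDensity
        fun z => ((z.1.2 ^ 2 * z.2.1).toNNReal : ℝ≥0∞))
      (volume.restrict {z | z.1 ∈ refTriangle ∧ 0 < z.2.2 ∧ z.2.2 < z.2.1 ∧ z.2.1 < z.1.2}) :=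
  measurePreserving_fibrewise (δ := fun z => (z.1 * z.2.1, z.1 * z.2.1 * z.2.2)) (by fun_prop)
    (ρ := fun z => (z.1 ^ 2 * z.2.1).toNNReal) (by fun_prop)
    (W := fun a => {z | 0 < z.2 ∧ z.2 < z.1 ∧ z.1 < a}) (by measurability)
    fun _ ha _ hg => lintegral_duffy ha hg

/-- The scaling of the unit square over the reference triangle. -/
theorem measurePreserving_square :
    MeasurePreserving
      (fun z : (ℝ × ℝ) × (ℝ × ℝ) => (z.1, (z.1.2 * z.2.1, z.1.2 * z.2.2)))
      ((volume.restrict (refTriangle ×ˢ unitSquare)).withDensity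
        fun z => ((z.1.2 ^ 2).toNNReal : ℝ≥0∞))
      (volume.restrict {z | z.1 ∈ refTriangle ∧ z.2 ∈ Ioo 0 z.1.2 ×ˢ Ioo 0 z.1.2}) :=
  measurePreserving_fibrewise (δ := fun z => (z.1 * z.2.1, z.1 * z.2.2)) (by fun_prop)
    (ρ := fun z => (z.1 ^ 2).toNNReal) (by fun_prop)
    (W := fun a => Ioo 0 a ×ˢ Ioo 0 a)
    (by simp only [mem_prod, mem_Ioo]; measurability)
    fun _ ha _ hg => lintegral_square ha hg

theorem measurePreserving_shear (Y : ℝ) :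
    MeasurePreserving (fun z : ℝ × ℝ => (Y - z.2, z.1 - z.2)) volume volume := by
  have h1 : MeasurePreserving (fun z : ℝ × ℝ => (z.1 - z.2, z.2)) volume volume :=
    measurePreserving_sub_prod volume volume
  have h2 : MeasurePreserving (Prod.swap : ℝ × ℝ → ℝ × ℝ) volume volume :=
    Measure.measurePreserving_swap
  have h3 : MeasurePreserving (Prod.map (fun y : ℝ => Y - y) (id : ℝ → ℝ)) volume volume :=
    (Measure.measurePreserving_sub_left volume Y).prod (MeasurePreserving.id _)
  exact h3.comp (h2.comp h1)

/-- `((Y, a), (t, r)) ↦ ((Y, a), (Y - r, t - r))` preserves Lebesgue measure. -/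
theorem measurePreserving_shearFst :
    MeasurePreserving (fun z : (ℝ × ℝ) × (ℝ × ℝ) => (z.1, (z.1.1 - z.2.2, z.2.1 - z.2.2)))
      volume volume :=
  (MeasurePreserving.id volume).skew_product (g := fun (x z : ℝ × ℝ) => (x.1 - z.2, z.1 - z.2))
    (by fun_prop) (Eventually.of_forall fun x => (measurePreserving_shear x.1).map_eq)

theorem measurePreserving_swap4 :
    MeasurePreserving (Prod.swap : (ℝ × ℝ) × (ℝ × ℝ) → (ℝ × ℝ) × (ℝ × ℝ)) volume volume :=
  Measure.measurePreserving_swap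

/-- `((Y, a), (t, r)) ↦ ((Y, a), (r, t))` preserves Lebesgue measure. -/
theorem measurePreserving_swapSnd :
    MeasurePreserving (fun z : (ℝ × ℝ) × (ℝ × ℝ) => (z.1, (z.2.2, z.2.1))) volume volume :=
  (MeasurePreserving.id volume).prod
    (Measure.measurePreserving_swap (μ := (volume : Measure ℝ)) (ν := (volume : Measure ℝ)))

/-- `((Y, a), (t, r)) ↦ ((Y, r), (a, t))` preserves Lebesgue measure. -/
theorem measurePreserving_rotate :
    MeasurePreserving (fun z : (ℝ × ℝ) × (ℝ × ℝ) => ((z.1.1, z.2.2), (z.1.2, z.2.1)))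
      volume volume := by
  have h1 : MeasurePreserving (MeasurableEquiv.prodAssoc : (ℝ × ℝ) × (ℝ × ℝ) ≃ᵐ _)
      volume volume := volume_preserving_prodAssoc
  have h2 : MeasurePreserving (MeasurableEquiv.prodAssoc : (ℝ × ℝ) × ℝ ≃ᵐ _)
      volume volume := volume_preserving_prodAssoc
  have h3 : MeasurePreserving (Prod.swap : (ℝ × ℝ) × ℝ → ℝ × (ℝ × ℝ)) volume volume :=
    Measure.measurePreserving_swap
  have h4 := (MeasurePreserving.id (volume : Measure ℝ)).prod (h3.comp h2.symm)
  exact h1.symm.comp (h4.comp h1)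

/-- `((Y, a), (t, r)) ↦ ((Y - t, a - t), (Y, r))` preserves Lebesgue measure. -/
theorem measurePreserving_shearSnd :
    MeasurePreserving (fun z : (ℝ × ℝ) × (ℝ × ℝ) =>
      ((z.1.1 - z.2.1, z.1.2 - z.2.1), (z.1.1, z.2.2))) volume volume :=
  measurePreserving_swap4.comp (measurePreserving_shearFst.comp measurePreserving_rotate)

theorem volume_ker_eq_zero (l : ((ℝ × ℝ) × (ℝ × ℝ)) →ₗ[ℝ] ℝ) (hl : l ≠ 0) :
    volume {z | l z = 0} = 0 :=
  have : (volume : Measure ((ℝ × ℝ) × (ℝ × ℝ))).IsAddHaarMeasure :=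
    inferInstanceAs ((volume : Measure (ℝ × ℝ)).prod (volume : Measure (ℝ × ℝ))).IsAddHaarMeasure
  Measure.addHaar_submodule volume (LinearMap.ker l) fun h => hl (LinearMap.ker_eq_top.1 h)

/-! ### The five parts of the product of two triangles. -/

/-- The parametrisations of the five parts of the product of two reference triangles. The
argument is `((Y, a), (η₃, η₄))`. -/
def edgeMap : Fin 5 → (ℝ × ℝ) × (ℝ × ℝ) → (ℝ × ℝ) × (ℝ × ℝ) :=
  ![fun z => ((z.1.1, z.1.2 * z.2.2), (z.1.1 - z.1.2 * z.2.1, z.1.2 - z.1.2 * z.2.1)),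
    fun z => (z.1, (z.1.1 - z.1.2 * z.2.1 * z.2.2, z.1.2 * z.2.1 - z.1.2 * z.2.1 * z.2.2)),
    fun z => ((z.1.1 - z.1.2 * z.2.1 * z.2.2, z.1.2 * z.2.1 - z.1.2 * z.2.1 * z.2.2), z.1),
    fun z => ((z.1.1 - z.1.2 * z.2.1, z.1.2 - z.1.2 * z.2.1), (z.1.1, z.1.2 * z.2.1 * z.2.2)),
    fun z => ((z.1.1 - z.1.2 * z.2.1 * z.2.2, z.1.2 - z.1.2 * z.2.1 * z.2.2),
      (z.1.1, z.1.2 * z.2.1))]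

/-- The Jacobians of the five parametrisations. -/
def edgeJac : Fin 5 → (ℝ × ℝ) × (ℝ × ℝ) → ℝ :=
  ![fun z => z.1.2 ^ 2, fun z => z.1.2 ^ 2 * z.2.1, fun z => z.1.2 ^ 2 * z.2.1,
    fun z => z.1.2 ^ 2 * z.2.1, fun z => z.1.2 ^ 2 * z.2.1]

/-- The five parts of the product of two reference triangles. -/
def edgeRegion : Fin 5 → Set ((ℝ × ℝ) × (ℝ × ℝ)) :=
  ![{z | (z.1 ∈ refTriangle ∧ z.2 ∈ refTriangle) ∧ z.2.1 < z.1.1 ∧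
      z.1.2 < z.2.2 + (z.1.1 - z.2.1)},
    {z | (z.1 ∈ refTriangle ∧ z.2 ∈ refTriangle) ∧ z.2.1 < z.1.1 ∧
      z.2.2 + (z.1.1 - z.2.1) < z.1.2},
    {z | (z.1 ∈ refTriangle ∧ z.2 ∈ refTriangle) ∧ z.1.1 < z.2.1 ∧
      z.1.2 + (z.2.1 - z.1.1) < z.2.2},
    {z | (z.1 ∈ refTriangle ∧ z.2 ∈ refTriangle) ∧ z.1.1 < z.2.1 ∧ z.2.2 < z.2.1 - z.1.1},
    {z | (z.1 ∈ refTriangle ∧ z.2 ∈ refTriangle) ∧ z.1.1 < z.2.1 ∧ z.2.1 - z.1.1 < z.2.2 ∧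
      z.2.2 < z.1.2 + (z.2.1 - z.1.1)}]

theorem measurableSet_edgeRegion (i : Fin 5) : MeasurableSet (edgeRegion i) := by
  fin_cases i <;> simp only [edgeRegion, refTriangle, Fin.zero_eta, Fin.mk_one, Fin.reduceFinMk,
    Matrix.cons_val] <;> measurability

theorem measurable_edgeJac (i : Fin 5) : Measurable (edgeJac i) := by
  fin_cases i <;> simp only [edgeJac, Fin.zero_eta, Fin.mk_one, Fin.reduceFinMk,
    Matrix.cons_val] <;> fun_prop

theorem edgeJac_nonneg (i : Fin 5) {z : (ℝ × ℝ) × (ℝ × ℝ)}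
    (hz : z ∈ refTriangle ×ˢ unitSquare) : 0 ≤ edgeJac i z := by
  have h1 : 0 ≤ z.2.1 := hz.2.1.1.le
  fin_cases i <;> simp only [edgeJac, Fin.zero_eta, Fin.mk_one, Fin.reduceFinMk,
    Matrix.cons_val] <;> positivity

/-- With this, each parametrisation factors into a scaling by `a` and a volume-preserving linear
map; all that remains is to check that the linear map pulls the part back to the scaled domain. -/
theorem measurePreserving_comp_restrict {α β γ : Type*} [MeasurableSpace α] [MeasurableSpace β]
    [MeasurableSpace γ] {μ : Measure α} {ν : Measure β} {κ : Measure γ} {s : Set β} {t : Set γ}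
    {f : α → β} {g : β → γ} (hf : MeasurePreserving f μ (ν.restrict s))
    (hg : MeasurePreserving g ν κ) (ht : MeasurableSet t) (hs : g ⁻¹' t = s) :
    MeasurePreserving (g ∘ f) μ (κ.restrict t) :=
  (hs ▸ hg.restrict_preimage ht).comp hf

theorem measurePreserving_edgeMap (i : Fin 5) :
    MeasurePreserving (edgeMap i)
      ((volume.restrict (refTriangle ×ˢ unitSquare)).withDensity
        fun z => ((edgeJac i z).toNNReal : ℝ≥0∞))
      (volume.restrict (edgeRegion i)) := by
  have hm := measurableSet_edgeRegion i
  fin_cases i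
  · exact (measurePreserving_comp_restrict measurePreserving_square
      (measurePreserving_swap4.comp measurePreserving_shearSnd) hm (by
        ext z
        simp only [edgeRegion, refTriangle, Fin.zero_eta, Function.comp, Prod.swap, mem_prod, mem_Ioo, Matrix.cons_val,
          mem_preimage, mem_ofPred_eq]
        grind) :)
  · exact (measurePreserving_comp_restrict measurePreserving_duffy
      (measurePreserving_shearFst) hm (by
        ext z
        simp only [edgeRegion, refTriangle, Fin.mk_one, Matrix.cons_val,
          mem_preimage, mem_ofPred_eq]
        grind) :)
  · exact (measurePreserving_comp_restrict measurePreserving_duffy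
      (measurePreserving_swap4.comp measurePreserving_shearFst) hm (by
        ext z
        simp only [edgeRegion, refTriangle, Fin.reduceFinMk, Function.comp, Prod.swap, Matrix.cons_val,
          mem_preimage, mem_ofPred_eq]
        grind) :)
  · exact (measurePreserving_comp_restrict measurePreserving_duffy
      (measurePreserving_shearSnd) hm (by
        ext z
        simp only [edgeRegion, refTriangle, Fin.reduceFinMk, Matrix.cons_val,
          mem_preimage, mem_ofPred_eq]
        grind) :)
  · exact (measurePreserving_comp_restrict measurePreserving_duffy
      (measurePreserving_shearSnd.comp measurePreserving_swapSnd) hm (by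
        ext z
        simp only [edgeRegion, refTriangle, Fin.reduceFinMk, Function.comp, Matrix.cons_val,
          mem_preimage, mem_ofPred_eq]
        grind) :)

theorem pairwise_disjoint_edgeRegion : Pairwise (Function.onFun Disjoint edgeRegion) := by
  intro i j hij
  rw [Function.onFun, Set.disjoint_left]
  intro z hi hj
  fin_cases i <;> fin_cases j <;>
    simp only [edgeRegion, refTriangle, Fin.zero_eta, Fin.mk_one, Fin.reduceFinMk,
      Matrix.cons_val, mem_ofPred_eq, ne_eq, not_true_eq_false] at hi hj hij <;>
    linarith

theorem iUnion_edgeRegion_ae_eq :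
    (⋃ i, edgeRegion i : Set ((ℝ × ℝ) × (ℝ × ℝ))) =ᵐ[volume] refTriangle ×ˢ refTriangle := by
  let π₁ : ((ℝ × ℝ) × (ℝ × ℝ)) →ₗ[ℝ] ℝ := LinearMap.fst ℝ ℝ ℝ ∘ₗ LinearMap.fst ℝ _ _
  let π₂ : ((ℝ × ℝ) × (ℝ × ℝ)) →ₗ[ℝ] ℝ := LinearMap.snd ℝ ℝ ℝ ∘ₗ LinearMap.fst ℝ _ _
  let π₃ : ((ℝ × ℝ) × (ℝ × ℝ)) →ₗ[ℝ] ℝ := LinearMap.fst ℝ ℝ ℝ ∘ₗ LinearMap.snd ℝ _ _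
  let π₄ : ((ℝ × ℝ) × (ℝ × ℝ)) →ₗ[ℝ] ℝ := LinearMap.snd ℝ ℝ ℝ ∘ₗ LinearMap.snd ℝ _ _
  -- The five strict systems of inequalities miss only points on three hyperplanes through the
  -- origin, where one of the comparisons becomes an equality.
  have h1 : ∀ᵐ z : (ℝ × ℝ) × (ℝ × ℝ), (π₁ - π₃) z ≠ 0 :=
    measure_eq_zero_iff_ae_notMem.1 (volume_ker_eq_zero _ fun h => by
      simpa [π₁, π₃] using LinearMap.congr_fun h ((1, 0), (0, 0)))
  have h2 : ∀ᵐ z : (ℝ × ℝ) × (ℝ × ℝ), (π₂ - π₄ - π₁ + π₃) z ≠ 0 :=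
    measure_eq_zero_iff_ae_notMem.1 (volume_ker_eq_zero _ fun h => by
      simpa [π₁, π₂, π₃, π₄] using LinearMap.congr_fun h ((1, 0), (0, 0)))
  have h3 : ∀ᵐ z : (ℝ × ℝ) × (ℝ × ℝ), (π₄ - π₃ + π₁) z ≠ 0 :=
    measure_eq_zero_iff_ae_notMem.1 (volume_ker_eq_zero _ fun h => by
      simpa [π₁, π₃, π₄] using LinearMap.congr_fun h ((1, 0), (0, 0)))
  refine Filter.eventuallyEq_set.2 ?_
  filter_upwards [h1, h2, h3] with z h1 h2 h3
  simp [π₁, π₂, π₃, π₄] at h1 h2 h3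
  simp only [mem_iUnion, mem_prod]
  constructor
  · rintro ⟨i, hi⟩
    fin_cases i <;> exact hi.1
  · intro hz
    by_contra hcon
    simp only [not_exists] at hcon
    have e0 := hcon 0
    have e1 := hcon 1
    have e2 := hcon 2
    have e3 := hcon 3
    have e4 := hcon 4
    simp only [edgeRegion, Matrix.cons_val, mem_ofPred_eq, hz.1, hz.2] at e0 e1 e2 e3 e4
    grind

theorem restrict_refTriangle_prod :
    (volume : Measure ((ℝ × ℝ) × (ℝ × ℝ))).restrict (refTriangle ×ˢ refTriangle) =
      ∑ i, volume.restrict (edgeRegion i) := by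
  rw [← Measure.restrict_congr_set iUnion_edgeRegion_ae_eq,
    Measure.restrict_iUnion pairwise_disjoint_edgeRegion measurableSet_edgeRegion,
    Measure.sum_fintype]

theorem integrable_edgeRegion_iff {f : (ℝ × ℝ) × (ℝ × ℝ) → ℝ} (hf : Measurable f) (i : Fin 5) :
    IntegrableOn f (edgeRegion i) ↔
      IntegrableOn (fun z => edgeJac i z * f (edgeMap i z)) (refTriangle ×ˢ unitSquare) := by
  have hm := measurePreserving_edgeMap i
  have hT : MeasurableSet (refTriangle ×ˢ unitSquare) :=
    measurableSet_refTriangle.prod measurableSet_unitSquare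
  rw [IntegrableOn, ← hm.integrable_comp hf.aestronglyMeasurable,
    integrable_withDensity_iff_integrable_smul (measurable_edgeJac i).real_toNNReal]
  refine integrable_congr ?_
  filter_upwards [ae_restrict_mem hT] with z hz
  simp [NNReal.smul_def, edgeJac_nonneg i hz]

theorem integral_edgeRegion {f : (ℝ × ℝ) × (ℝ × ℝ) → ℝ} (hf : Measurable f) (i : Fin 5) :
    ∫ z in edgeRegion i, f z =
      ∫ z in refTriangle ×ˢ unitSquare, edgeJac i z * f (edgeMap i z) := by
  have hm := measurePreserving_edgeMap i
  have hT : MeasurableSet (refTriangle ×ˢ unitSquare) :=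
    measurableSet_refTriangle.prod measurableSet_unitSquare
  rw [← hm.map_eq, integral_map hm.measurable.aemeasurable hf.aestronglyMeasurable,
    integral_withDensity_eq_integral_smul (measurable_edgeJac i).real_toNNReal]
  refine integral_congr_ae ?_
  filter_upwards [ae_restrict_mem hT] with z hz
  simp [NNReal.smul_def, edgeJac_nonneg i hz]

theorem integrableOn_refTriangle_prod {f : (ℝ × ℝ) × (ℝ × ℝ) → ℝ} (hf : Measurable f)
    (h : ∀ i, IntegrableOn (fun z => edgeJac i z * f (edgeMap i z)) (refTriangle ×ˢ unitSquare)) :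
    IntegrableOn f (refTriangle ×ˢ refTriangle) := by
  rw [IntegrableOn, restrict_refTriangle_prod, integrable_finsetSum_measure]
  exact fun i _ => (integrable_edgeRegion_iff hf i).2 (h i)

theorem integral_refTriangle_prod {f : (ℝ × ℝ) × (ℝ × ℝ) → ℝ} (hf : Measurable f)
    (h : ∀ i, IntegrableOn (fun z => edgeJac i z * f (edgeMap i z)) (refTriangle ×ˢ unitSquare)) :
    ∫ z in refTriangle ×ˢ refTriangle, f z =
      ∑ i, ∫ z in refTriangle ×ˢ unitSquare, edgeJac i z * f (edgeMap i z) := by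
  rw [restrict_refTriangle_prod, integral_finsetSum_measure
    fun i _ => (integrable_edgeRegion_iff hf i).2 (h i)]
  exact Finset.sum_congr rfl fun i _ => integral_edgeRegion hf i

/-! ### Cancellation of the singularity and integration over `(Y, a)`. -/

/-- The coefficient of `c₁` in the five regularised integrands. -/
def edgeWeight₁ : Fin 5 → ℝ × ℝ → ℝ :=
  ![fun η => η.1, fun η => η.1 * η.2, fun _ => 0, fun _ => 0, fun _ => 0]

/-- The coefficient of `c₂` in the five regularised integrands. -/
def edgeWeight₂ : Fin 5 → ℝ × ℝ → ℝ :=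
  ![fun η => 1 - η.1, fun η => η.1 * (1 - η.2), fun _ => 1, fun η => η.1 * η.2, fun η => η.1]

theorem edgeIntegrand_eq_mul (u v w : E3) (c₀ c₁ c₂ : ℝ) (i : Fin 5) (η : ℝ × ℝ) :
    edgeIntegrand u v w c₀ c₁ c₂ i η =
      edgeIntegrand u v w 1 0 0 i η * (c₀ + c₁ * edgeWeight₁ i η + c₂ * edgeWeight₂ i η) := by
  fin_cases i <;> simp only [edgeIntegrand, edgeWeight₁, edgeWeight₂, Fin.zero_eta, Fin.mk_one,
    Fin.reduceFinMk, Matrix.cons_val] <;> ring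

theorem continuous_edgeWeight₁ (i : Fin 5) : Continuous (edgeWeight₁ i) := by
  fin_cases i <;> simp only [edgeWeight₁, Fin.zero_eta, Fin.mk_one, Fin.reduceFinMk,
    Matrix.cons_val] <;> fun_prop

theorem continuous_edgeWeight₂ (i : Fin 5) : Continuous (edgeWeight₂ i) := by
  fin_cases i <;> simp only [edgeWeight₂, Fin.zero_eta, Fin.mk_one, Fin.reduceFinMk,
    Matrix.cons_val] <;> fun_prop

/-- The integrand of the double layer integral in reference coordinates, without constants. -/
def refIntegrand (u v w : E3) (a₀ a₁ a₂ : ℝ) (z : (ℝ × ℝ) × (ℝ × ℝ)) : ℝ :=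
  z.1.2 / ‖(z.1.1 - z.2.1) • v + z.1.2 • w - z.2.2 • u‖ ^ 3 * (a₀ + a₁ * z.2.1 + a₂ * z.2.2)

theorem measurable_refIntegrand (u v w : E3) (a₀ a₁ a₂ : ℝ) :
    Measurable (refIntegrand u v w a₀ a₁ a₂) := by
  unfold refIntegrand
  refine Measurable.mul (Measurable.div (by fun_prop) (Continuous.measurable ?_)) (by fun_prop)
  fun_prop

theorem div_norm_smul_cube {a : ℝ} (ha : 0 < a) (b : ℝ) (x : E3) :
    a ^ 2 * (a * b / ‖a • x‖ ^ 3) = b / ‖x‖ ^ 3 := by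
  rw [norm_smul, Real.norm_eq_abs, abs_of_pos ha, mul_pow, mul_div_assoc', ← mul_assoc,
    ← pow_succ]
  exact mul_div_mul_left _ _ (by positivity)

theorem edgeJac_mul_refIntegrand (u v w : E3) (a₀ a₁ a₂ : ℝ) (i : Fin 5)
    {z : (ℝ × ℝ) × (ℝ × ℝ)} (ha : 0 < z.1.2) :
    edgeJac i z * refIntegrand u v w a₀ a₁ a₂ (edgeMap i z) =
      edgeIntegrand u v w 1 0 0 i z.2 * (a₀ + a₁ * z.1.1 +
        (a₂ * edgeWeight₂ i z.2 - a₁ * edgeWeight₁ i z.2) * z.1.2) := by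
  obtain ⟨⟨Y, a⟩, ⟨s, q⟩⟩ := z
  simp only at ha
  have hneg : ∀ x : E3, ‖x‖ = ‖-x‖ := fun x => (norm_neg x).symm
  fin_cases i
  · simp only [edgeJac, refIntegrand, edgeMap, edgeIntegrand, edgeWeight₁, edgeWeight₂,
      Fin.zero_eta, Matrix.cons_val]
    rw [show (Y - (Y - a * s)) • v + (a * q) • w - (a - a * s) • u
      = a • (s • (u + v) + q • w - u) by module,
      ← div_norm_smul_cube ha q]
    ring
  · simp only [edgeJac, refIntegrand, edgeMap, edgeIntegrand, edgeWeight₁, edgeWeight₂,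
      Fin.mk_one, Matrix.cons_val]
    rw [show (Y - (Y - a * s * q)) • v + a • w - (a * s - a * s * q) • u
      = a • ((s * q) • (u + v) - s • u + w) by module,
      ← div_norm_smul_cube ha s]
    ring
  · simp only [edgeJac, refIntegrand, edgeMap, edgeIntegrand, edgeWeight₁, edgeWeight₂,
      Fin.reduceFinMk, Matrix.cons_val]
    -- Here and in the next two parts the vector is a negative multiple of the one in the
    -- regularised denominator.
    rw [hneg, show -((Y - a * s * q - Y) • v + (a * s - a * s * q) • w - a • u)
      = a • ((s * q) • (w + v) - s • w + u) by module,
      ← div_norm_smul_cube ha (s ^ 2 * (1 - q))]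
    ring
  · simp only [edgeJac, refIntegrand, edgeMap, edgeIntegrand, edgeWeight₁, edgeWeight₂,
      Fin.reduceFinMk, Matrix.cons_val]
    rw [hneg, show -((Y - a * s - Y) • v + (a - a * s) • w - (a * s * q) • u)
      = a • ((s * q) • u + s • (w + v) - w) by module,
      ← div_norm_smul_cube ha (s * (1 - s))]
    ring
  · simp only [edgeJac, refIntegrand, edgeMap, edgeIntegrand, edgeWeight₁, edgeWeight₂,
      Fin.reduceFinMk, Matrix.cons_val]
    rw [hneg, show -((Y - a * s * q - Y) • v + (a - a * s * q) • w - (a * s) • u)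
      = a • ((s * q) • (w + v) + s • u - w) by module,
      ← div_norm_smul_cube ha (s * (1 - s * q))]
    ring

theorem setIntegral_refTriangle {g : ℝ × ℝ → ℝ} (hg : Continuous g) :
    ∫ x in refTriangle, g x = ∫ y in (0 : ℝ)..1, ∫ a in (0 : ℝ)..y, g (y, a) := by
  have hint : IntegrableOn g refTriangle := by
    refine (hg.continuousOn.integrableOn_compact (μ := volume)
      (isCompact_Icc.prod isCompact_Icc (s := Icc (0 : ℝ) 1) (t := Icc (0 : ℝ) 1))).mono_set ?_
    rintro x ⟨h1, h2, h3, h4⟩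
    exact ⟨⟨h1.le, h2.le⟩, ⟨h3.le, (h4.trans h2).le⟩⟩
  rw [← integral_indicator measurableSet_refTriangle, Measure.volume_eq_prod,
    integral_prod _ ((integrable_indicator_iff measurableSet_refTriangle).2 hint),
    intervalIntegral.integral_of_le zero_le_one, integral_Ioc_eq_integral_Ioo,
    ← integral_indicator measurableSet_Ioo]
  refine integral_congr_ae (Eventually.of_forall fun y => ?_)
  by_cases hy : y ∈ Ioo (0 : ℝ) 1
  · simp only
    rw [indicator_of_mem hy, intervalIntegral.integral_of_le hy.1.le,
      integral_Ioc_eq_integral_Ioo, ← integral_indicator measurableSet_Ioo]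
    refine integral_congr_ae (Eventually.of_forall fun a => ?_)
    by_cases ha : a ∈ Ioo 0 y
    · simp only
      rw [indicator_of_mem ha, indicator_of_mem]
      exact ⟨hy.1, hy.2, ha.1, ha.2⟩
    · simp only
      rw [indicator_of_notMem ha, indicator_of_notMem]
      exact fun h => ha ⟨h.2.2.1, h.2.2.2⟩
  · simp only
    rw [indicator_of_notMem hy]
    refine integral_eq_zero_of_ae (Eventually.of_forall fun a => indicator_of_notMem ?_ _)
    exact fun h => hy ⟨h.1, h.2.1⟩

theorem integral_refTriangle_affine (a₀ a₁ : ℝ) :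
    ∫ x in refTriangle, (a₀ + a₁ * x.1) = a₀ / 2 + a₁ / 3 := by
  rw [setIntegral_refTriangle (by fun_prop)]
  have : ∀ y : ℝ, ∫ _ in (0 : ℝ)..y, (a₀ + a₁ * y) = a₀ * y + a₁ * y ^ 2 := by
    intro y; simp; ring
  simp only [this]
  rw [intervalIntegral.integral_add (Continuous.intervalIntegrable (by fun_prop) _ _)
    (Continuous.intervalIntegrable (by fun_prop) _ _), intervalIntegral.integral_const_mul,
    intervalIntegral.integral_const_mul, integral_id, integral_pow]
  norm_num
  ring

theorem integral_refTriangle_snd : ∫ x in refTriangle, x.2 = 1 / 6 := by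
  rw [setIntegral_refTriangle (by fun_prop)]
  simp
  norm_num

section Regular

variable {u v w : E3}
  (hreg : ∀ i : Fin 5, ContinuousOn (edgeIntegrand u v w 1 0 0 i)
    (Icc (0 : ℝ) 1 ×ˢ Icc (0 : ℝ) 1))
include hreg

theorem integrableOn_edge_mul (i : Fin 5) {g : (ℝ × ℝ) × (ℝ × ℝ) → ℝ} (hg : Continuous g) :
    IntegrableOn (fun z => edgeIntegrand u v w 1 0 0 i z.2 * g z) (refTriangle ×ˢ unitSquare) := by
  have hK : IsCompact ((Icc (0 : ℝ) 1 ×ˢ Icc (0 : ℝ) 1) ×ˢ (Icc (0 : ℝ) 1 ×ˢ Icc (0 : ℝ) 1)) :=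
    (isCompact_Icc.prod isCompact_Icc).prod (isCompact_Icc.prod isCompact_Icc)
  refine (ContinuousOn.integrableOn_compact (μ := volume) hK ?_).mono_set ?_
  · exact ((hreg i).comp continuousOn_snd fun z hz => hz.2).mul hg.continuousOn
  · rintro z ⟨⟨h1, h2, h3, h4⟩, h5, h6⟩
    exact ⟨⟨⟨h1.le, h2.le⟩, h3.le, (h4.trans h2).le⟩, ⟨h5.1.le, h5.2.le⟩, h6.1.le, h6.2.le⟩

theorem integrableOn_edgeIntegrand (c₀ c₁ c₂ : ℝ) (i : Fin 5) :
    IntegrableOn (edgeIntegrand u v w c₀ c₁ c₂ i) unitSquare := by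
  have hw₁ := continuous_edgeWeight₁ i
  have hw₂ := continuous_edgeWeight₂ i
  refine (ContinuousOn.integrableOn_compact (μ := volume)
    (isCompact_Icc.prod isCompact_Icc (s := Icc (0 : ℝ) 1) (t := Icc (0 : ℝ) 1)) ?_).mono_set
    (prod_mono Ioo_subset_Icc_self Ioo_subset_Icc_self)
  refine ContinuousOn.congr ?_ fun η _ => edgeIntegrand_eq_mul u v w c₀ c₁ c₂ i η
  exact (hreg i).mul (Continuous.continuousOn (by fun_prop))

theorem integrableOn_edgeJac_mul (a₀ a₁ a₂ : ℝ) (i : Fin 5) :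
    IntegrableOn (fun z => edgeJac i z * refIntegrand u v w a₀ a₁ a₂ (edgeMap i z))
      (refTriangle ×ˢ unitSquare) := by
  have hw₁ := continuous_edgeWeight₁ i
  have hw₂ := continuous_edgeWeight₂ i
  refine (integrableOn_edge_mul hreg i (g := fun z => a₀ + a₁ * z.1.1 +
    (a₂ * edgeWeight₂ i z.2 - a₁ * edgeWeight₁ i z.2) * z.1.2) (by fun_prop)).congr_fun
    (fun z hz => (edgeJac_mul_refIntegrand u v w a₀ a₁ a₂ i hz.1.2.2.1).symm)
    (measurableSet_refTriangle.prod measurableSet_unitSquare)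

theorem integral_edgeJac_mul (a₀ a₁ a₂ : ℝ) (i : Fin 5) :
    ∫ z in refTriangle ×ˢ unitSquare, edgeJac i z * refIntegrand u v w a₀ a₁ a₂ (edgeMap i z) =
      edgeIntegral u v w (a₀ / 2 + a₁ / 3) (-a₁ / 6) (a₂ / 6) i := by
  have hw₁ := continuous_edgeWeight₁ i
  have hw₂ := continuous_edgeWeight₂ i
  -- The integrand is a sum of two products of a function of `(Y, a)` and a function of `η`, so
  -- Fubini leaves the integrals of `a₀ + a₁ Y` and of `a` over the reference triangle.
  have e1 : ∀ z ∈ refTriangle ×ˢ unitSquare,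
      edgeJac i z * refIntegrand u v w a₀ a₁ a₂ (edgeMap i z) =
      (a₀ + a₁ * z.1.1) * edgeIntegrand u v w 1 0 0 i z.2 +
        z.1.2 * (edgeIntegrand u v w 1 0 0 i z.2 *
          (a₂ * edgeWeight₂ i z.2 - a₁ * edgeWeight₁ i z.2)) := by
    intro z hz
    rw [edgeJac_mul_refIntegrand u v w a₀ a₁ a₂ i hz.1.2.2.1]
    ring
  have i1 : IntegrableOn (fun z : (ℝ × ℝ) × (ℝ × ℝ) =>
      (a₀ + a₁ * z.1.1) * edgeIntegrand u v w 1 0 0 i z.2) (refTriangle ×ˢ unitSquare) := by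
    simpa only [mul_comm] using integrableOn_edge_mul hreg i
      (g := fun z => a₀ + a₁ * z.1.1) (by fun_prop)
  have i2 : IntegrableOn (fun z : (ℝ × ℝ) × (ℝ × ℝ) =>
      z.1.2 * (edgeIntegrand u v w 1 0 0 i z.2 *
        (a₂ * edgeWeight₂ i z.2 - a₁ * edgeWeight₁ i z.2))) (refTriangle ×ˢ unitSquare) := by
    refine (integrableOn_edge_mul hreg i (g := fun z => z.1.2 *
      (a₂ * edgeWeight₂ i z.2 - a₁ * edgeWeight₁ i z.2)) (by fun_prop)).congr_fun
      (fun z _ => ?_) (measurableSet_refTriangle.prod measurableSet_unitSquare)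
    simp only; ring
  have j1 : IntegrableOn (edgeIntegrand u v w 1 0 0 i) unitSquare :=
    integrableOn_edgeIntegrand hreg 1 0 0 i
  have j2 : IntegrableOn (fun η => edgeIntegrand u v w 1 0 0 i η *
      (a₂ * edgeWeight₂ i η - a₁ * edgeWeight₁ i η)) unitSquare := by
    refine (integrableOn_edgeIntegrand hreg 0 (-a₁) a₂ i).congr_fun (fun η _ => ?_)
      measurableSet_unitSquare
    rw [edgeIntegrand_eq_mul]; ring
  rw [setIntegral_congr_fun (measurableSet_refTriangle.prod measurableSet_unitSquare) e1,
    integral_add i1 i2, Measure.volume_eq_prod,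
    setIntegral_prod_mul (fun x : ℝ × ℝ => a₀ + a₁ * x.1) (edgeIntegrand u v w 1 0 0 i),
    setIntegral_prod_mul (fun x : ℝ × ℝ => x.2) (fun η => edgeIntegrand u v w 1 0 0 i η *
      (a₂ * edgeWeight₂ i η - a₁ * edgeWeight₁ i η)), integral_refTriangle_affine,
    integral_refTriangle_snd, ← integral_const_mul, ← integral_const_mul,
    ← integral_add (j1.const_mul _) (j2.const_mul _), edgeIntegral]
  refine integral_congr_ae (Eventually.of_forall fun η => ?_)
  simp only
  rw [edgeIntegrand_eq_mul u v w (a₀ / 2 + a₁ / 3)]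
  ring

theorem integrableOn_refIntegrand (a₀ a₁ a₂ : ℝ) :
    IntegrableOn (refIntegrand u v w a₀ a₁ a₂) (refTriangle ×ˢ refTriangle) :=
  integrableOn_refTriangle_prod (measurable_refIntegrand u v w a₀ a₁ a₂)
    (integrableOn_edgeJac_mul hreg a₀ a₁ a₂)

theorem integral_refIntegrand (a₀ a₁ a₂ : ℝ) :
    ∫ z in refTriangle ×ˢ refTriangle, refIntegrand u v w a₀ a₁ a₂ z =
      ∑ i, edgeIntegral u v w (a₀ / 2 + a₁ / 3) (-a₁ / 6) (a₂ / 6) i := by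
  rw [integral_refTriangle_prod (measurable_refIntegrand u v w a₀ a₁ a₂)
    (integrableOn_edgeJac_mul hreg a₀ a₁ a₂)]
  exact Finset.sum_congr rfl fun i _ => integral_edgeJac_mul hreg a₀ a₁ a₂ i

end Regular

/-! ### Geometry of triangles that meet only in their edge. -/

theorem eq_zero_of_gramDet_ne_zero {x y : E3} (h : gramDet x y ≠ 0) {a b : ℝ}
    (hab : a • x + b • y = 0) : a = 0 ∧ b = 0 := by
  have hdet : ⟪x, x⟫ * ⟪y, y⟫ - ⟪x, y⟫ * ⟪x, y⟫ ≠ 0 := by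
    intro h0
    apply h
    rw [gramDet, Matrix.det_fin_two]
    simp only [Matrix.gram_apply, Matrix.cons_val_zero, Matrix.cons_val_one]
    rw [real_inner_comm x y, h0, Real.sqrt_zero]
  have e1 : a * ⟪x, x⟫ + b * ⟪x, y⟫ = 0 := by
    rw [← inner_smul_right, ← inner_smul_right, ← inner_add_right, hab, inner_zero_right]
  have e2 : a * ⟪x, y⟫ + b * ⟪y, y⟫ = 0 := by
    rw [← real_inner_comm x y, ← inner_smul_right, ← inner_smul_right, ← inner_add_right, hab,
      inner_zero_right]
  constructor
  · refine (mul_eq_zero.1 (?_ : a * (⟪x, x⟫ * ⟪y, y⟫ - ⟪x, y⟫ * ⟪x, y⟫) = 0)).resolve_right hdet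
    linear_combination ⟪y, y⟫ * e1 - ⟪x, y⟫ * e2
  · refine (mul_eq_zero.1 (?_ : b * (⟪x, x⟫ * ⟪y, y⟫ - ⟪x, y⟫ * ⟪x, y⟫) = 0)).resolve_right hdet
    linear_combination ⟪x, x⟫ * e2 - ⟪x, y⟫ * e1

theorem mem_closure_triangle (p a b : E3) {x y : ℝ} (hx : 0 < x) (hx1 : x < 1) (hy : 0 ≤ y)
    (hyx : y ≤ x) : p + x • a + y • b ∈ closure (triangle p a b) := by
  have h1 : y ∈ closure (Ioo 0 x) := by
    rw [closure_Ioo hx.ne]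
    exact ⟨hy, hyx⟩
  refine map_mem_closure (f := fun y : ℝ => p + x • a + y • b) (by fun_prop) h1 fun z hz => ?_
  exact ⟨(x, z), ⟨hx, hx1, hz.1, hz.2⟩, rfl⟩

/-- Two triangles meeting only in their common edge lie on different sides of that edge. -/
theorem eq_zero_of_triangles_meet_in_edge {p u v w : E3} (hτ : gramDet v u ≠ 0)
    (hσ : gramDet v w ≠ 0)
    (hedge : closure (triangle p v w) ∩ closure (triangle p v u) = segment ℝ p (p + v))
    {z α β : ℝ} (hα : 0 ≤ α) (hβ : 0 ≤ β) (h : z • v + α • w - β • u = 0) :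
    z = 0 ∧ α = 0 ∧ β = 0 := by
  -- The relation is scaled down so that, starting from the midpoint of the edge, both displaced
  -- points stay inside their closed triangles; the bound `1/4` leaves room on every side.
  obtain ⟨ε, hε, hs⟩ : ∃ ε : ℝ, 0 < ε ∧ ε * (|z| + α + β) ≤ 1 / 4 := by
    refine ⟨1 / 4 / (|z| + α + β + 1), by positivity, ?_⟩
    rw [div_mul_eq_mul_div, div_le_iff₀ (by positivity)]
    linarith
  have hz1 : ε * z ≤ ε * |z| := mul_le_mul_of_nonneg_left (le_abs_self z) hε.le
  have hz2 : -(ε * |z|) ≤ ε * z := by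
    rw [← mul_neg]; exact mul_le_mul_of_nonneg_left (neg_abs_le z) hε.le
  have ha : 0 ≤ ε * |z| := by positivity
  have hb : 0 ≤ ε * α := by positivity
  have hc : 0 ≤ ε * β := by positivity
  have hsum : ε * |z| + ε * α + ε * β ≤ 1 / 4 := by linarith
  have h1 : p + (1 / 2 + ε * z) • v + (ε * α) • w ∈ closure (triangle p v w) :=
    mem_closure_triangle p v w (by linarith) (by linarith) hb (by linarith)
  have h2 : p + (1 / 2 : ℝ) • v + (ε * β) • u ∈ closure (triangle p v u) :=
    mem_closure_triangle p v u (by norm_num) (by norm_num) hc (by linarith)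
  have h3 : p + (1 / 2 + ε * z) • v + (ε * α) • w = p + (1 / 2 : ℝ) • v + (ε * β) • u := by
    rw [← sub_eq_zero]
    calc _ = ε • (z • v + α • w - β • u) := by module
      _ = 0 := by rw [h, smul_zero]
  rw [h3] at h1
  have hmem : _ ∈ segment ℝ p (p + v) := hedge.subset ⟨h1, h2⟩
  rw [segment_eq_image'] at hmem
  obtain ⟨θ, -, hθ⟩ := hmem
  simp only [add_sub_cancel_left] at hθ
  -- The relation makes the two points equal, so the common point lies on the edge. Independence of
  -- `v, u` gives `β = 0`, and then independence of `v, w` gives the rest.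
  have h4 : (1 / 2 - θ) • v + (ε * β) • u = 0 := by
    rw [← sub_eq_zero] at hθ
    rw [← neg_zero, ← hθ]; module
  have hβ0 : β = 0 := (mul_eq_zero.1 (eq_zero_of_gramDet_ne_zero hτ h4).2).resolve_left hε.ne'
  rw [hβ0, zero_smul, sub_zero] at h
  obtain ⟨h5, h6⟩ := eq_zero_of_gramDet_ne_zero hσ h
  exact ⟨h5, h6, hβ0⟩

/-- Up to sign each denominator vector is `z v + α w - β u` with `α, β ≥ 0` on the closed square,
and in each case the coefficients cannot vanish together. -/
theorem continuousOn_edgeIntegrand {u v w : E3}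
    (h : ∀ z α β : ℝ, 0 ≤ α → 0 ≤ β → z • v + α • w - β • u = 0 → z = 0 ∧ α = 0 ∧ β = 0)
    (i : Fin 5) :
    ContinuousOn (edgeIntegrand u v w 1 0 0 i) (Icc (0 : ℝ) 1 ×ˢ Icc (0 : ℝ) 1) := by
  fin_cases i
  all_goals
    refine ContinuousOn.mul (ContinuousOn.div (by fun_prop) (by fun_prop) ?_) (by fun_prop)
    rintro ⟨s, q⟩ ⟨⟨hs0, hs1⟩, ⟨hq0, hq1⟩⟩
    simp only at hs0 hs1 hq0 hq1
    have hsq0 : 0 ≤ s * q := mul_nonneg hs0 hq0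
    have hsq1 : s * q ≤ s := mul_le_of_le_one_right hs0 hq1
    refine pow_ne_zero 3 (norm_ne_zero_iff.2 fun h0 => ?_)
    simp only at h0
  · obtain ⟨e1, e2, e3⟩ := h s q (1 - s) hq0 (by linarith) (by rw [← h0]; module)
    linarith
  · obtain ⟨e1, e2, e3⟩ := h (s * q) 1 (s - s * q) zero_le_one (by linarith)
      (by rw [← h0]; module)
    linarith
  · obtain ⟨e1, e2, e3⟩ := h (-(s * q)) (s - s * q) 1 (by linarith) zero_le_one
      (by rw [← neg_zero, ← h0]; module)
    linarith
  · obtain ⟨e1, e2, e3⟩ := h (-s) (1 - s) (s * q) (by linarith) hsq0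
      (by rw [← neg_zero, ← h0]; module)
    linarith
  · obtain ⟨e1, e2, e3⟩ := h (-(s * q)) (1 - s * q) s (by linarith) hs0
      (by rw [← neg_zero, ← h0]; module)
    linarith

/-! ### From reference coordinates to surface integrals. -/

theorem measurableEmbedding_chart {p a b : E3} (h : gramDet a b ≠ 0) :
    MeasurableEmbedding (chart p a b) := by
  refine (continuous_chart p a b).measurableEmbedding fun x y hxy => ?_
  have h0 : (x.1 - y.1) • a + (x.2 - y.2) • b = 0 := by
    have h1 : chart p a b x - chart p a b y = 0 := sub_eq_zero.2 hxy
    rw [← h1, chart, chart]; module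
  obtain ⟨h1, h2⟩ := eq_zero_of_gramDet_ne_zero h h0
  exact Prod.ext (sub_eq_zero.1 h1) (sub_eq_zero.1 h2)

theorem restrict_triangle_prod (p a b c : E3) :
    ((μHE[2] : Measure E3).restrict (triangle p a b)).prod
        ((μHE[2] : Measure E3).restrict (triangle p a c)) =
      (ENNReal.ofReal (gramDet a b) * ENNReal.ofReal (gramDet a c)) •
        (volume.restrict (refTriangle ×ˢ refTriangle)).map
          (Prod.map (chart p a b) (chart p a c)) := by
  rw [restrict_triangle, restrict_triangle, Measure.prod_smul_left, Measure.prod_smul_right,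
    smul_smul, Measure.map_prod_map _ _ (continuous_chart p a b).measurable
      (continuous_chart p a c).measurable, Measure.prod_restrict]
  rfl

/-- The surface measure on the whole space is not s-finite; Fubini applies only to its restrictions
to the triangles. -/
theorem sFinite_restrict_triangle (p a b : E3) :
    SFinite ((μHE[2] : Measure E3).restrict (triangle p a b)) := by
  rw [restrict_triangle]; infer_instance

theorem kernel_chart_mul {p u v w n : E3} {φ : E3 → ℝ} {a₀ a₁ a₂ : ℝ} (hnv : ⟪v, n⟫ = 0)
    (hnu : ⟪u, n⟫ = 0)
    (hφ : ∀ y ∈ refTriangle, φ (chart p v u y) = a₀ + a₁ * y.1 + a₂ * y.2)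
    {z : (ℝ × ℝ) × (ℝ × ℝ)} (hz : z ∈ refTriangle ×ˢ refTriangle) :
    kernel n (chart p v w z.1) (chart p v u z.2) * φ (chart p v u z.2) =
      ⟪w, n⟫ / (4 * Real.pi) * refIntegrand u v w a₀ a₁ a₂ z := by
  have e : chart p v w z.1 - chart p v u z.2
      = (z.1.1 - z.2.1) • v + z.1.2 • w - z.2.2 • u := by
    rw [chart, chart]; module
  rw [hφ _ hz.2, kernel, e, refIntegrand, inner_sub_left, inner_add_left, inner_smul_left,
    inner_smul_left, inner_smul_left, hnv, hnu]
  simp only [conj_trivial]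
  rw [mul_zero, mul_zero, zero_add, sub_zero]
  ring

section Surface

variable {p u v w n : E3} {φ : E3 → ℝ} {a₀ a₁ a₂ : ℝ}
  (hτ : gramDet v u ≠ 0) (hσ : gramDet v w ≠ 0)
  (hreg : ∀ i : Fin 5, ContinuousOn (edgeIntegrand u v w 1 0 0 i)
    (Icc (0 : ℝ) 1 ×ˢ Icc (0 : ℝ) 1))
  (hnv : ⟪v, n⟫ = 0) (hnu : ⟪u, n⟫ = 0)
  (hφ : ∀ y ∈ refTriangle, φ (chart p v u y) = a₀ + a₁ * y.1 + a₂ * y.2)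
include hτ hσ hreg hnv hnu hφ

theorem integrable_kernel_mul :
    Integrable (fun z : E3 × E3 => kernel n z.1 z.2 * φ z.2)
      (((μHE[2] : Measure E3).restrict (triangle p v w)).prod
        ((μHE[2] : Measure E3).restrict (triangle p v u))) := by
  rw [restrict_triangle_prod]
  refine Integrable.smul_measure ?_ (ENNReal.mul_ne_top ENNReal.ofReal_ne_top
    ENNReal.ofReal_ne_top)
  rw [((measurableEmbedding_chart hσ).prodMap (measurableEmbedding_chart hτ)).integrable_map_iff]
  exact IntegrableOn.congr_fun ((integrableOn_refIntegrand hreg a₀ a₁ a₂).const_mul _)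
    (fun z hz => (kernel_chart_mul hnv hnu hφ hz).symm)
    (measurableSet_refTriangle.prod measurableSet_refTriangle)

theorem doubleLayerIntegral_eq :
    doubleLayerIntegral (triangle p v w) (triangle p v u) n φ =
      gramDet v w * gramDet v u / (4 * Real.pi) * ⟪w, n⟫ *
        ∑ i, edgeIntegral u v w (a₀ / 2 + a₁ / 3) (-a₁ / 6) (a₂ / 6) i := by
  have hint := integrable_kernel_mul hτ hσ hreg hnv hnu hφ
  have := sFinite_restrict_triangle p v w
  have := sFinite_restrict_triangle p v u
  have h := integral_prod _ hint
  have hcongr := setIntegral_congr_fun (μ := volume)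
    (measurableSet_refTriangle.prod measurableSet_refTriangle)
    (fun z hz => kernel_chart_mul (z := z) (w := w) hnv hnu hφ hz)
  rw [doubleLayerIntegral, ← h, restrict_triangle_prod, integral_smul_measure,
    ((measurableEmbedding_chart hσ).prodMap (measurableEmbedding_chart hτ)).integral_map]
  simp only [Prod.map_fst, Prod.map_snd]
  rw [hcongr, integral_const_mul, integral_refIntegrand hreg, ENNReal.toReal_mul,
    ENNReal.toReal_ofReal (by unfold gramDet; positivity),
    ENNReal.toReal_ofReal (by unfold gramDet; positivity), smul_eq_mul]
  ring

end Surface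

end DoubleLayer

end

/-! ### Assembly of the theorem. -/

theorem mainTheorem3
    (p u v w n : DoubleLayer.E3) (φ : DoubleLayer.E3 → ℝ) (a₀ a₁ a₂ c₀ c₁ c₂ : ℝ)
    (σ τ : Set DoubleLayer.E3)
    (hτ : τ = DoubleLayer.triangle p v u) (hσ : σ = DoubleLayer.triangle p v w)
    (hgτ : DoubleLayer.gramDet v u ≠ 0) (hgσ : DoubleLayer.gramDet v w ≠ 0)
    (hedge : closure σ ∩ closure τ = segment ℝ p (p + v))
    (hn : ‖n‖ = 1) (hnv : ⟪v, n⟫ = 0) (hnu : ⟪u, n⟫ = 0)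
    (hφ : ∀ y ∈ DoubleLayer.refTriangle,
      φ (DoubleLayer.chart p v u y) = a₀ + a₁ * y.1 + a₂ * y.2)
    (hc₀ : c₀ = a₀ / 2 + a₁ / 3) (hc₁ : c₁ = -a₁ / 6) (hc₂ : c₂ = a₂ / 6) :
    -- all integrals in the first formula converge absolutely
    Integrable (fun z : DoubleLayer.E3 × DoubleLayer.E3 =>
        DoubleLayer.kernel n z.1 z.2 * φ z.2)
      (((μHE[2] : Measure DoubleLayer.E3).restrict σ).prod
        ((μHE[2] : Measure DoubleLayer.E3).restrict τ)) ∧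
    (∀ i, IntegrableOn (DoubleLayer.edgeIntegrand u v w c₀ c₁ c₂ i)
      (Ioo (0 : ℝ) 1 ×ˢ Ioo (0 : ℝ) 1)) ∧
    DoubleLayer.doubleLayerIntegral σ τ n φ =
      DoubleLayer.gramDet v w * DoubleLayer.gramDet v u / (4 * Real.pi) * ⟪w, n⟫ *
        ∑ i, DoubleLayer.edgeIntegral u v w c₀ c₁ c₂ i ∧
    -- for triangles in one plane the integral vanishes
    (⟪w, n⟫ = 0 → DoubleLayer.doubleLayerIntegral σ τ n φ = 0) ∧
    -- otherwise every integral is a difference of two explicit one-dimensional integrals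
    (⟪w, n⟫ ≠ 0 →
      (∀ i, ∀ η₃ ∈ Icc (0 : ℝ) 1,
        ∫ η₄ in (0 : ℝ)..1, DoubleLayer.edgeIntegrand u v w c₀ c₁ c₂ i (η₃, η₄) =
          (DoubleLayer.edgeParams u v w c₀ c₁ c₂ i 1).h η₃
            - (DoubleLayer.edgeParams u v w c₀ c₁ c₂ i 0).h η₃) ∧
      (∀ i, DoubleLayer.edgeIntegral u v w c₀ c₁ c₂ i =
        (∫ η in (0 : ℝ)..1, (DoubleLayer.edgeParams u v w c₀ c₁ c₂ i 1).h η)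
          - ∫ η in (0 : ℝ)..1, (DoubleLayer.edgeParams u v w c₀ c₁ c₂ i 0).h η) ∧
      -- and these are evaluated in closed form
      ∀ (i : Fin 5) (j : Fin 2) (S : DoubleLayer.Params),
        S = DoubleLayer.edgeParams u v w c₀ c₁ c₂ i j →
        0 < S.q ∧ 0 < S.d ∧ (∀ η, 0 < S.Q η) ∧ (∀ η, 0 < S.D η) ∧
        IntervalIntegrable S.h volume 0 1 ∧
        -- partial fractions
        (∀ η, S.h η = 1 / (S.d * √(S.Q η)) *
          (S.p₂ - S.d₁ * S.p₃ + S.p₃ * η + (S.n + S.m * η) / S.Dm η)) ∧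
        -- the fractional linear substitution
        (S.d₁ ≠ S.q₁ → ∃ ν μ : ℝ, ν < μ ∧
          (∀ z : ℝ, (S.d₁ - S.q₁) * z ^ 2 + 2 * (S.d₀ - S.q₀) * z
              + (S.q₁ * S.d₀ - S.d₁ * S.q₀) = 0 ↔ z = ν ∨ z = μ) ∧
          (∀ η, η ≠ μ → HasDerivAt (fun x => S.H ν μ (DoubleLayer.subst ν μ x))
            ((S.n + S.m * η) / (S.Dm η * √(S.Qm η))) η) ∧
          Tendsto (S.H ν μ) atTop (𝓝 (S.HTop ν μ)) ∧
          Tendsto (S.H ν μ) atBot (𝓝 (S.HBot ν μ)) ∧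
          (μ ≠ 0 → μ ≠ 1 → ∀ t₀ t₁ : ℝ,
            t₀ = min (-ν / μ) (-(ν - 1) / (μ - 1)) →
            t₁ = max (-ν / μ) (-(ν - 1) / (μ - 1)) →
            ((-1 < t₀ ∨ t₁ < -1) ∧
              ∫ η in (0 : ℝ)..1, S.h η =
                1 / (S.d * √S.q) * (S.E 1 - S.E 0 + (S.H ν μ t₁ - S.H ν μ t₀))) ∨
            ((t₀ < -1 ∧ -1 < t₁) ∧
              ∫ η in (0 : ℝ)..1, S.h η =
                1 / (S.d * √S.q) * (S.E 1 - S.E 0 +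
                  (S.H ν μ t₀ - S.HBot ν μ + S.HTop ν μ - S.H ν μ t₁)))) ∧
          (μ = 0 → ∫ η in (0 : ℝ)..1, S.h η =
            1 / (S.d * √S.q) * (S.E 1 - S.E 0 + (S.H ν μ (ν - 1) - S.HBot ν μ))) ∧
          (μ = 1 → ∫ η in (0 : ℝ)..1, S.h η =
            1 / (S.d * √S.q) * (S.E 1 - S.E 0 + (S.HTop ν μ - S.H ν μ (-ν))))) ∧
        -- the substitution degenerates to a shift
        (S.d₁ = S.q₁ → S.d₀ ≠ S.q₀ → ∫ η in (0 : ℝ)..1, S.h η =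
          1 / (S.d * √S.q) * (S.E 1 - S.E 0 +
            (S.HShift (1 + S.q₁ / 2) - S.HShift (S.q₁ / 2)))) ∧
        (S.d₁ = S.q₁ → S.d₀ = S.q₀ → ∫ η in (0 : ℝ)..1, S.h η =
          1 / (S.d * √S.q) * (S.E 1 - S.E 0 +
            (S.HProp (1 + S.q₁ / 2) - S.HProp (S.q₁ / 2))))) := by
  subst hτ hσ
  have hreg := DoubleLayer.continuousOn_edgeIntegrand fun z α β hα hβ h =>
    DoubleLayer.eq_zero_of_triangles_meet_in_edge hgτ hgσ hedge hα hβ h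
  have hJ := DoubleLayer.doubleLayerIntegral_eq hgτ hgσ hreg hnv hnu hφ
  rw [← hc₀, ← hc₁, ← hc₂] at hJ
  have hint := DoubleLayer.integrableOn_edgeIntegrand hreg c₀ c₁ c₂
  refine ⟨DoubleLayer.integrable_kernel_mul hgτ hgσ hreg hnv hnu hφ, hint, hJ,
    fun h0 => by rw [hJ, h0, mul_zero, zero_mul], fun hwn => ?_⟩
  -- Pairing with `n` isolates the coefficient of `w`; the other two vanish because `τ` is
  -- nondegenerate. This independence makes `Q` and `D` positive on the whole line, not only on `[0,
  -- 1]`.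
  have hli : ∀ a b c : ℝ, a • u + b • v + c • w = 0 → a = 0 ∧ b = 0 ∧ c = 0 := by
    intro a b c h
    have hc : c = 0 := by
      have h1 : ⟪a • u + b • v + c • w, n⟫ = 0 := by rw [h, inner_zero_left]
      rw [inner_add_left, inner_add_left, inner_smul_left, inner_smul_left, inner_smul_left, hnv,
        hnu, mul_zero, mul_zero, zero_add, zero_add] at h1
      exact (mul_eq_zero.1 h1).resolve_right hwn
    rw [hc, zero_smul, add_zero, add_comm] at h
    obtain ⟨h1, h2⟩ := DoubleLayer.eq_zero_of_gramDet_ne_zero hgτ h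
    exact ⟨h2, h1, hc⟩
  refine ⟨fun i η _ => DoubleLayer.integral_edgeIntegrand_slice hli c₀ c₁ c₂ i η,
    fun i => DoubleLayer.edgeIntegral_eq hli c₀ c₁ c₂ i (hint i), ?_⟩
  rintro i j S rfl
  exact DoubleLayer.Params.closed_form (DoubleLayer.tabQ_pos hli i j) (DoubleLayer.tabD_pos hli i)
    (DoubleLayer.edgeParams_Qm_pos hli c₀ c₁ c₂ i j)
    (DoubleLayer.edgeParams_Dm_pos hli c₀ c₁ c₂ i j)
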